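/- **Theorem (coordinate Bethe ansatz for square ice).** *Transfer matrix.* A cell has one of six symbols: empty; one curve going from south to north; one curve from south to east; one curve from west to north; two curves, one from west to north and one from south to east; one curve from west to east. Let $N\ge 1$. An $(N,1)$-cylindric pattern is a row $w=(w_1,\dots,w_N)$ of symbols such that, for every $k$ (indices modulo $N$), a curve crosses the east side of $w_k$ if and only if a curve crosses the west side of $w_{k+1}$. Let $|w|$ be the number of cells of $w$ whose symbol is a single turning curve (south to east, or west to north). For words $\boldsymbol\epsilon,\boldsymbol\eta\in\{0,1\}^N$, the pattern $w$ links $\boldsymbol\epsilon$ to $\boldsymbol\eta$ if, for every $k$, a curve crosses the south side of $w_k$ if and only if $\boldsymbol\epsilon_k=1$, and a curve crosses the north side of $w_k$ if and only if $\boldsymbol\eta_k=1$. Let $V_N(t)$ be the $2^N\times 2^N$ matrix, indexed by $\{0,1\}^N$, with entries $V_N(t)[\boldsymbol\epsilon,\boldsymbol\eta]=\sum_w t^{|w|}$, the sum being over the cylindric patterns $w$ linking $\boldsymbol\epsilon$ to $\boldsymbol\eta$. *Auxiliary functions.* For $t\in(0,2)$ let $\Delta_t=\frac{2-t^2}{2}$,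 $\mu_t=\arccos(-\Delta_t)\in(0,\pi)$ and $I_t=(-(\pi-\mu_t),\pi-\mu_t)$. Let $(t,x,y)\mapsto\Theta_t(x,y)$ be the unique real analytic function from $\{(t,x,y): t\in(0,2),\ x,y\in I_t\}$ to $\mathbb R$ such that $\Theta_{\sqrt2}(0,0)=0$ and $$e^{-i\Theta_t(x,y)}=e^{i(x-y)}\,\frac{e^{-ix}+e^{iy}-2\Delta_t}{e^{-iy}+e^{ix}-2\Delta_t}.$$ For $z\in\mathbb C\setminus\{1\}$ let $L_t(z)=1+\frac{t^2z}{1-z}$ and $M_t(z)=1-\frac{t^2}{1-z}$. *Vector.* For $p=(p_1,\dots,p_n)\in I_t^n$ let $\psi_{t,n,N}(p)\in\mathbb C^{\{0,1\}^N}$ be the vector whose coordinate at a word $\boldsymbol\epsilon$ with exactly $n$ letters $1$, at positions $q_1[\boldsymbol\epsilon]<\dots<q_n[\boldsymbol\epsilon]$ in $\{1,\dots,N\}$, is $$\psi_{t,n,N}(p)[\boldsymbol\epsilon]=\sum_{\sigma\in\Sigma_n}\operatorname{sgn}(\sigma)\prod_{1\le k<l\le n}e^{ip_{\sigma(k)}}\left(e^{-ip_{\sigma(k)}}+e^{ip_{\sigma(l)}}-2\Delta_t\right)\prod_{k=1}^n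 e^{ip_{\sigma(k)}q_k[\boldsymbol\epsilon]},$$ and whose coordinates at all other words are $0$. *Eigenvalue.* Let $p_1<\dots<p_n$ in $I_t$. If $p_j\ne0$ for all $j$, let $$\Lambda_{n,N}(t)[p]=\prod_{k=1}^nL_t(e^{ip_k})+\prod_{k=1}^nM_t(e^{ip_k}).$$ If $p_l=0$ for some (necessarily unique) $l$, let $$\Lambda_{n,N}(t)[p]=\Bigl(2+t^2(N-1)+t^2\sum_{k\ne l}\frac{\partial\Theta_t}{\partial x}(0,p_k)\Bigr)\prod_{k\ne l}M_t(e^{ip_k}).$$ *Statement.* Let $t\in(0,2)$, $N\ge1$ and $0\le n\le N/2$, and let $p_1<\dots<p_n$ in $I_t$ satisfy, for all $1\le j\le n$, the Bethe equations $$Np_j=2\pi j-(n+1)\pi-\sum_{k=1}^n\Theta_t(p_j,p_k).$$ Then $$V_N(t)\,\psi_{t,n,N}(p)=\Lambda_{n,N}(t)[p]\;\psi_{t,n,N}(p).$$ -/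

import Mathlib

namespace SquareIce

/-! ## The discrete curves model and the transfer matrix -/

/-- The six symbols of the drifting discrete curves representation of square ice. A curve
enters a cell through its south or west side and leaves it through its north or east side. -/
inductive Symb : Type
  /-- no curve -/
  | empty
  /-- one curve, from south to north -/
  | vertical
  /-- one curve, from south to east -/
  | southEast
  /-- one curve, from west to north -/
  | westNorth
  /-- two curves, one from west to north and one from south to east -/
  | double
  /-- one curve, from west to east -/
  | horizontal
  deriving DecidableEq

namespace Symb

instance : Fintype Symb where
  elems := {empty, vertical, southEast, westNorth, double, horizontal}
  complete x := by cases x <;> decide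

/-- Whether a curve crosses the south side of the symbol. -/
def south : Symb → Bool
  | empty => false
  | vertical => true
  | southEast => true
  | westNorth => false
  | double => true
  | horizontal => false

/-- Whether a curve crosses the north side of the symbol. -/
def north : Symb → Bool
  | empty => false
  | vertical => true
  | southEast => false
  | westNorth => true
  | double => true
  | horizontal => false

/-- Whether a curve crosses the west side of the symbol. -/
def west : Symb → Bool
  | empty => false
  | vertical => false
  | southEast => false
  | westNorth => true
  | double => true
  | horizontal => true

/-- Whether a curve crosses the east side of the symbol. -/
def east : Symb → Bool
  | empty => false
  | vertical => false
  | southEast => true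
  | westNorth => false
  | double => true
  | horizontal => true

end Symb

/-- The words of length `N` on the alphabet `{0, 1}` (`false` is `0`, `true` is `1`); they index
the canonical basis of `Ω_N = ℂ² ⊗ ⋯ ⊗ ℂ²`. -/
abbrev Word (N : ℕ) : Type := Fin N → Bool

/-- A row of `N` symbols is an `(N, 1)`-cylindric pattern when it can be wrapped on the cylinder:
every symbol and its (cyclic) right neighbour agree on their common side. (Any such row, repeated
periodically, extends to a configuration of the whole plane, by letting the curves which leave it
go on vertically.) -/
def IsCylindric {N : ℕ} (w : Fin N → Symb) : Prop :=
  ∀ k : Fin N, (w k).east = (w (finRotate N k)).west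

/-- The pattern `w` links `ε` to `η`: a curve enters through the south side (resp. leaves through
the north side) at position `k` if and only if `ε_k = 1` (resp. `η_k = 1`). -/
def Links {N : ℕ} (ε : Word N) (w : Fin N → Symb) (η : Word N) : Prop :=
  (∀ k, (w k).south = ε k) ∧ ∀ k, (w k).north = η k

/-- `|w|`: the number of symbols of `w` that consist of exactly one turning curve. -/
def turnCount {N : ℕ} (w : Fin N → Symb) : ℕ :=
  (Finset.univ.filter fun k => w k = Symb.southEast ∨ w k = Symb.westNorth).card

open Classical in
/-- The transfer matrix `V_N(t)`, with entries `V_N(t)[ε, η] = ∑ t ^ |w|`, the sum being over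
the cylindric patterns `w` linking `ε` to `η`. -/
noncomputable def transferMatrix (N : ℕ) (t : ℝ) : Matrix (Word N) (Word N) ℂ :=
  Matrix.of fun ε η =>
    ∑ w ∈ (Finset.univ : Finset (Fin N → Symb)).filter (fun w => IsCylindric w ∧ Links ε w η),
      (t : ℂ) ^ turnCount w

/-! ## Auxiliary functions -/

/-- `Δ_t = (2 - t²) / 2`. -/
noncomputable def Delta (t : ℝ) : ℝ := (2 - t ^ 2) / 2

/-- `μ_t = arccos (-Δ_t)`. -/
noncomputable def muAngle (t : ℝ) : ℝ := Real.arccos (-Delta t)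

/-- The interval `I_t = (-(π - μ_t), π - μ_t)`. -/
noncomputable def Interval (t : ℝ) : Set ℝ := Set.Ioo (-(Real.pi - muAngle t)) (Real.pi - muAngle t)

/-- The set of all `(t, x, y)` with `t ∈ (0, 2)` and `x, y ∈ I_t`. -/
def thetaDomain : Set (ℝ × ℝ × ℝ) :=
  {q | q.1 ∈ Set.Ioo (0 : ℝ) 2 ∧ q.2.1 ∈ Interval q.1 ∧ q.2.2 ∈ Interval q.1}

/-- The characterization of the function `Θ` on `thetaDomain`: it is real analytic,
`Θ_{√2}(0, 0) = 0`, and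
`exp(-iΘ_t(x, y)) = exp(i(x - y)) (e^{-ix} + e^{iy} - 2Δ_t) / (e^{-iy} + e^{ix} - 2Δ_t)`. -/
structure IsTheta (F : ℝ → ℝ → ℝ → ℝ) : Prop where
  analytic : AnalyticOnNhd ℝ (fun q : ℝ × ℝ × ℝ => F q.1 q.2.1 q.2.2) thetaDomain
  normalized : F (Real.sqrt 2) 0 0 = 0
  exp_eq : ∀ t x y : ℝ, (t, x, y) ∈ thetaDomain →
    Complex.exp (-Complex.I * (F t x y : ℂ)) =
      Complex.exp (Complex.I * ((x : ℂ) - (y : ℂ))) *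
        ((Complex.exp (-Complex.I * x) + Complex.exp (Complex.I * y) - 2 * (Delta t : ℂ)) /
          (Complex.exp (-Complex.I * y) + Complex.exp (Complex.I * x) - 2 * (Delta t : ℂ)))

/-- An explicit form of the function `Θ_t(x, y)`. On `thetaDomain` it is the unique function
satisfying `IsTheta`: see `isTheta_Theta` and `IsTheta.eq_Theta` below. -/
noncomputable def Theta (t x y : ℝ) : ℝ :=
  -2 * Complex.arg
    (⟨Real.cos ((x + y) / 2) - Delta t * Real.cos ((x - y) / 2),
      -(Delta t * Real.sin ((x - y) / 2))⟩ : ℂ)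

lemma Delta_mem {t : ℝ} (ht : t ∈ Set.Ioo (0 : ℝ) 2) : -1 < Delta t ∧ Delta t < 1 := by
  obtain ⟨h0, h2⟩ := ht
  unfold Delta
  constructor <;> nlinarith

lemma Interval_eq (t : ℝ) :
    Interval t = Set.Ioo (-Real.arccos (Delta t)) (Real.arccos (Delta t)) := by
  simp [Interval, muAngle, Real.arccos_neg]

/-- The complex number whose argument defines `Theta` avoids the closed negative real axis. -/
lemma mem_slitPlane {t x y : ℝ} (h : (t, x, y) ∈ thetaDomain) :
    (⟨Real.cos ((x + y) / 2) - Delta t * Real.cos ((x - y) / 2),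
      -(Delta t * Real.sin ((x - y) / 2))⟩ : ℂ) ∈ Complex.slitPlane := by
  obtain ⟨ht, hx, hy⟩ := h
  simp only [Interval_eq, Set.mem_Ioo] at ht hx hy
  obtain ⟨hd1, hd2⟩ := Delta_mem ht
  have hpi := Real.arccos_le_pi (Delta t)
  rw [Complex.mem_slitPlane_iff]
  by_contra! hc
  obtain ⟨hre, him⟩ := hc
  simp only [neg_eq_zero, mul_eq_zero] at hre him
  rcases him with h0 | hs
  · rw [h0, Real.arccos_zero] at hx hy
    have := Real.cos_pos_of_mem_Ioo (x := (x + y) / 2) ⟨by linarith, by linarith⟩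
    rw [h0] at hre
    linarith
  · have hxy : (x - y) / 2 = 0 :=
      (Real.sin_eq_zero_iff_of_lt_of_lt (by linarith) (by linarith)).1 hs
    have hxy' : (x + y) / 2 = x := by linarith
    rw [hxy, hxy', Real.cos_zero] at hre
    have h1 : Real.cos (Real.arccos (Delta t)) < Real.cos |x| :=
      Real.cos_lt_cos_of_nonneg_of_le_pi (abs_nonneg x) hpi (abs_lt.2 hx)
    rw [Real.cos_arccos hd1.le hd2.le, Real.cos_abs] at h1
    linarith

lemma isPreconnected_thetaDomain : IsPreconnected thetaDomain := by
  have hS : IsPreconnected (Set.Ioo (0 : ℝ) 2 ×ˢ (Set.Ioo (-1 : ℝ) 1 ×ˢ Set.Ioo (-1 : ℝ) 1)) :=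
    isPreconnected_Ioo.prod (isPreconnected_Ioo.prod isPreconnected_Ioo)
  have hf : Continuous fun q : ℝ × ℝ × ℝ =>
      (q.1, q.2.1 * Real.arccos (Delta q.1), q.2.2 * Real.arccos (Delta q.1)) := by
    unfold Delta
    have := Real.continuous_arccos
    fun_prop
  convert hS.image _ hf.continuousOn using 1
  ext ⟨t, x, y⟩
  simp only [thetaDomain, Interval_eq, Set.mem_ofPred_eq, Set.mem_image, Set.mem_prod,
    Set.mem_Ioo, Prod.mk.injEq, Prod.exists]
  constructor
  · rintro ⟨ht, hx, hy⟩
    have hA : 0 < Real.arccos (Delta t) := Real.arccos_pos.2 (Delta_mem ht).2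
    refine ⟨t, x / Real.arccos (Delta t), y / Real.arccos (Delta t),
      ⟨ht, ⟨?_, ?_⟩, ?_, ?_⟩, rfl, ?_, ?_⟩
    · rw [lt_div_iff₀ hA]; linarith
    · rw [div_lt_iff₀ hA]; linarith
    · rw [lt_div_iff₀ hA]; linarith
    · rw [div_lt_iff₀ hA]; linarith
    · field_simp
    · field_simp
  · rintro ⟨t, u, v, ⟨ht, hu, hv⟩, rfl, rfl, rfl⟩
    have hA : 0 < Real.arccos (Delta t) := Real.arccos_pos.2 (Delta_mem ht).2
    refine ⟨ht, ⟨?_, ?_⟩, ?_, ?_⟩ <;> nlinarith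

lemma sqrt_two_mem : ((Real.sqrt 2, 0, 0) : ℝ × ℝ × ℝ) ∈ thetaDomain := by
  have h : Delta (Real.sqrt 2) = 0 := by simp [Delta]
  have hpi := Real.pi_pos
  refine ⟨⟨by positivity, ?_⟩, ?_, ?_⟩
  · rw [Real.sqrt_lt' (by norm_num)]; norm_num
  · simp only [Interval_eq, h, Real.arccos_zero, Set.mem_Ioo]; constructor <;> linarith
  · simp only [Interval_eq, h, Real.arccos_zero, Set.mem_Ioo]; constructor <;> linarith

lemma exp_neg_two_arg (z : ℂ) (hz : z ≠ 0) :
    Complex.exp (-Complex.I * ((-2 * Complex.arg z : ℝ) : ℂ)) = z / (starRingEnd ℂ) z := by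
  have hn : (‖z‖ : ℂ) ≠ 0 := by simpa using hz
  have h := Complex.norm_mul_exp_arg_mul_I z
  have h2 : (‖z‖ : ℂ) * Complex.exp (-(Complex.arg z * Complex.I)) = (starRingEnd ℂ) z := by
    conv_rhs => rw [← h]
    rw [map_mul, ← Complex.exp_conj]
    simp
  have e1 : -Complex.I * ((-2 * Complex.arg z : ℝ) : ℂ)
      = Complex.arg z * Complex.I - -(Complex.arg z * Complex.I) := by push_cast; ring
  rw [e1, Complex.exp_sub, ← h2]
  nth_rewrite 3 [← h]
  rw [mul_div_mul_left _ _ hn]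

/-- `Theta` has the properties which define the function `Θ`. -/
theorem isTheta_Theta : IsTheta Theta where
  analytic := by
    rintro ⟨t, x, y⟩ h
    have hs := mem_slitPlane h
    have hf : AnalyticAt ℝ (fun q : ℝ × ℝ × ℝ =>
        (Complex.ofRealCLM (Real.cos ((q.2.1 + q.2.2) / 2)
            - Delta q.1 * Real.cos ((q.2.1 - q.2.2) / 2))
          + Complex.ofRealCLM (-(Delta q.1 * Real.sin ((q.2.1 - q.2.2) / 2))) * Complex.I : ℂ))
        (t, x, y) := by
      unfold Delta
      have f1 : AnalyticAt ℝ (fun q : ℝ × ℝ × ℝ => q.1) (t, x, y) := analyticAt_fst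
      have f2 : AnalyticAt ℝ (fun q : ℝ × ℝ × ℝ => q.2.1) (t, x, y) :=
        analyticAt_fst.comp analyticAt_snd
      have f3 : AnalyticAt ℝ (fun q : ℝ × ℝ × ℝ => q.2.2) (t, x, y) :=
        analyticAt_snd.comp analyticAt_snd
      have h1 : ∀ v : ℝ, AnalyticAt ℝ (Complex.ofRealCLM : ℝ → ℂ) v :=
        fun v => Complex.ofRealCLM.analyticAt v
      refine AnalyticAt.add ((h1 _).fun_comp ?_) (AnalyticAt.mul ((h1 _).fun_comp ?_) analyticAt_const)
      · fun_prop
      · fun_prop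
    have hfe : ∀ q : ℝ × ℝ × ℝ,
        (Complex.ofRealCLM (Real.cos ((q.2.1 + q.2.2) / 2)
            - Delta q.1 * Real.cos ((q.2.1 - q.2.2) / 2))
          + Complex.ofRealCLM (-(Delta q.1 * Real.sin ((q.2.1 - q.2.2) / 2))) * Complex.I : ℂ)
        = ⟨Real.cos ((q.2.1 + q.2.2) / 2) - Delta q.1 * Real.cos ((q.2.1 - q.2.2) / 2),
            -(Delta q.1 * Real.sin ((q.2.1 - q.2.2) / 2))⟩ := fun q => by
      rw [Complex.mk_eq_add_mul_I]; rfl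
    simp only [hfe] at hf
    have hl : AnalyticAt ℝ (fun q : ℝ × ℝ × ℝ => Complex.log
        ⟨Real.cos ((q.2.1 + q.2.2) / 2) - Delta q.1 * Real.cos ((q.2.1 - q.2.2) / 2),
          -(Delta q.1 * Real.sin ((q.2.1 - q.2.2) / 2))⟩) (t, x, y) :=
      AnalyticAt.comp_of_eq ((analyticAt_clog hs).restrictScalars (𝕜 := ℝ)) hf rfl
    have hi : AnalyticAt ℝ (fun q : ℝ × ℝ × ℝ => Complex.arg
        ⟨Real.cos ((q.2.1 + q.2.2) / 2) - Delta q.1 * Real.cos ((q.2.1 - q.2.2) / 2),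
          -(Delta q.1 * Real.sin ((q.2.1 - q.2.2) / 2))⟩) (t, x, y) :=
      (AnalyticAt.comp_of_eq (Complex.imCLM.analyticAt _) hl rfl).congr
        (Filter.Eventually.of_forall fun q => Complex.log_im _)
    exact analyticAt_const.mul hi
  normalized := by
    have h : Delta (Real.sqrt 2) = 0 := by simp [Delta]
    have h1 : (⟨1, 0⟩ : ℂ) = 1 := rfl
    simp [Theta, h, h1]
  exp_eq := by
    intro t x y h
    have hs := mem_slitPlane h
    have hz := Complex.slitPlane_ne_zero hs
    unfold Theta
    rw [exp_neg_two_arg _ hz]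
    generalize hze : (⟨Real.cos ((x + y) / 2) - Delta t * Real.cos ((x - y) / 2),
      -(Delta t * Real.sin ((x - y) / 2))⟩ : ℂ) = z at hz
    have hzc : (starRingEnd ℂ) z ≠ 0 := by simpa using hz
    obtain ⟨s, hsd⟩ : ∃ s : ℝ, s = (x + y) / 2 := ⟨_, rfl⟩
    obtain ⟨d, hdd⟩ : ∃ d : ℝ, d = (x - y) / 2 := ⟨_, rfl⟩
    obtain rfl : x = s + d := by linarith
    obtain rfl : y = s - d := by linarith
    rw [← hsd, ← hdd] at hze
    have e0 : Complex.exp (d * Complex.I) * Complex.exp (-d * Complex.I) = 1 := by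
      rw [← Complex.exp_add]; simp
    have c1 : Complex.exp (s * Complex.I) = Complex.cos s + Complex.sin s * Complex.I :=
      Complex.exp_mul_I _
    have c2 : Complex.exp (-s * Complex.I) = Complex.cos s - Complex.sin s * Complex.I := by
      rw [Complex.exp_mul_I, Complex.cos_neg, Complex.sin_neg]; ring
    have hz1 : z = Complex.cos s - Delta t * Complex.exp (d * Complex.I) := by
      rw [← hze, Complex.mk_eq_add_mul_I, Complex.exp_mul_I]; push_cast; ring
    have hz2 : (starRingEnd ℂ) z = Complex.cos s - Delta t * Complex.exp (-d * Complex.I) := by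
      rw [hz1, map_sub, map_mul, ← Complex.exp_conj, ← Complex.cos_conj]; simp
    have hn : Complex.exp (-Complex.I * ((s + d : ℝ) : ℂ))
        + Complex.exp (Complex.I * ((s - d : ℝ) : ℂ)) - 2 * (Delta t : ℂ)
        = 2 * Complex.exp (-d * Complex.I) * z := by
      have a1 : -Complex.I * ((s + d : ℝ) : ℂ) = -s * Complex.I + -d * Complex.I := by
        push_cast; ring
      have a2 : Complex.I * ((s - d : ℝ) : ℂ) = s * Complex.I + -d * Complex.I := by
        push_cast; ring
      rw [a1, a2, Complex.exp_add, Complex.exp_add, c1, c2, hz1]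
      linear_combination (2 * (Delta t : ℂ)) * e0
    have hd : Complex.exp (-Complex.I * ((s - d : ℝ) : ℂ))
        + Complex.exp (Complex.I * ((s + d : ℝ) : ℂ)) - 2 * (Delta t : ℂ)
        = 2 * Complex.exp (d * Complex.I) * (starRingEnd ℂ) z := by
      have a1 : -Complex.I * ((s - d : ℝ) : ℂ) = -s * Complex.I + d * Complex.I := by
        push_cast; ring
      have a2 : Complex.I * ((s + d : ℝ) : ℂ) = s * Complex.I + d * Complex.I := by
        push_cast; ring
      rw [a1, a2, Complex.exp_add, Complex.exp_add, c1, c2, hz2]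
      linear_combination (2 * (Delta t : ℂ)) * e0
    have hp : Complex.I * (((s + d : ℝ) : ℂ) - ((s - d : ℝ) : ℂ))
        = d * Complex.I + d * Complex.I := by push_cast; ring
    rw [hn, hd, hp, Complex.exp_add]
    have hE := Complex.exp_ne_zero (d * Complex.I)
    rw [show Complex.exp (-d * Complex.I) = (Complex.exp (d * Complex.I))⁻¹ by
      rw [neg_mul, Complex.exp_neg]]
    field_simp

/-- `Theta` is the only function on `thetaDomain` with these properties. -/
theorem IsTheta.eq_Theta {F : ℝ → ℝ → ℝ → ℝ} (hF : IsTheta F) {t x y : ℝ}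
    (h : (t, x, y) ∈ thetaDomain) : F t x y = Theta t x y := by
  have hpi := Real.pi_pos
  let g : ℝ × ℝ × ℝ → ℝ := fun q => (F q.1 q.2.1 q.2.2 - Theta q.1 q.2.1 q.2.2) / (2 * Real.pi)
  have hg : ContinuousOn g thetaDomain :=
    (hF.analytic.continuousOn.sub isTheta_Theta.analytic.continuousOn).div_const _
  have hint : ∀ q ∈ thetaDomain, ∃ m : ℤ, g q = m := by
    rintro ⟨t, x, y⟩ hq
    have e := (hF.exp_eq t x y hq).trans (isTheta_Theta.exp_eq t x y hq).symm
    obtain ⟨m, hm⟩ := Complex.exp_eq_exp_iff_exists_int.1 e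
    refine ⟨-m, ?_⟩
    have hm' : (F t x y : ℂ) = (Theta t x y : ℂ) - m * (2 * Real.pi) := by
      have := congrArg (fun w => Complex.I * w) hm
      ring_nf at this
      rw [Complex.I_sq] at this
      linear_combination this
    have hm2 : F t x y = Theta t x y - m * (2 * Real.pi) := by exact_mod_cast hm'
    simp only [g, hm2]
    push_cast
    field_simp
    ring
  have hconst : (g '' thetaDomain).Subsingleton := by
    have hpre := isPreconnected_thetaDomain.image g hg
    intro a ha b hb
    by_contra hab
    wlog hlt : a < b generalizing a b
    · exact this hb ha (Ne.symm hab) (lt_of_le_of_ne (not_lt.1 hlt) (Ne.symm hab))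
    have hsub := hpre.Icc_subset ha hb
    obtain ⟨qa, hqa, rfl⟩ := ha
    obtain ⟨m, hm⟩ := hint qa hqa
    obtain ⟨c, hc1, hc2⟩ := exists_between (lt_min hlt (lt_add_one (g qa)))
    obtain ⟨qc, hqc, rfl⟩ := hsub ⟨hc1.le, (hc2.trans_le (min_le_left _ _)).le⟩
    obtain ⟨k, hk⟩ := hint qc hqc
    have hc3 := hc2.trans_le (min_le_right _ _)
    rw [hm, hk] at hc1 hc3
    have i1 : m < k := by exact_mod_cast hc1
    have i2 : k < m + 1 := by exact_mod_cast hc3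
    omega
  have h1 := hconst ⟨_, h, rfl⟩ ⟨_, sqrt_two_mem, rfl⟩
  simp only [g, hF.normalized, isTheta_Theta.normalized] at h1
  field_simp at h1
  linarith

/-- `L_t(z) = 1 + t² z / (1 - z)`, used for `z ≠ 1`. -/
noncomputable def L (t : ℝ) (z : ℂ) : ℂ := 1 + (t : ℂ) ^ 2 * z / (1 - z)

/-- `M_t(z) = 1 - t² / (1 - z)`, used for `z ≠ 1`. -/
noncomputable def M (t : ℝ) (z : ℂ) : ℂ := 1 - (t : ℂ) ^ 2 / (1 - z)

/-! ## The Bethe vector and the candidate eigenvalue -/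

/-- The set of (zero-based) positions `k` such that `ε_k = 1`. -/
def ones {N : ℕ} (ε : Word N) : Finset (Fin N) := Finset.univ.filter fun k => ε k = true

/-- `q_k[ε] ∈ {1, …, N}`, the `k`-th position (in increasing order) at which the word `ε`, with
exactly `n` letters `1`, has a letter `1`. -/
def position {N n : ℕ} (ε : Word N) (h : (ones ε).card = n) (k : Fin n) : ℕ :=
  ((ones ε).orderEmbOfFin h k : ℕ) + 1

/-- The coefficients `C_σ(t)[p_1, …, p_n]`. -/
noncomputable def coeffC {n : ℕ} (t : ℝ) (p : Fin n → ℝ) (σ : Equiv.Perm (Fin n)) : ℂ :=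
  ((Equiv.Perm.sign σ : ℤ) : ℂ) *
    ∏ k : Fin n, ∏ l ∈ Finset.Ioi k,
      Complex.exp (Complex.I * p (σ k)) *
        (Complex.exp (-Complex.I * p (σ k)) + Complex.exp (Complex.I * p (σ l))
          - 2 * (Delta t : ℂ))

/-- The vector `ψ_{t,n,N}(p_1, …, p_n)` of `Ω_N`, which lies in the span `Ω_N^{(n)}` of the basis
words with exactly `n` letters `1`. -/
noncomputable def betheVector {n : ℕ} (t : ℝ) (N : ℕ) (p : Fin n → ℝ) : Word N → ℂ := fun ε =>
  if h : (ones ε).card = n then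
    ∑ σ : Equiv.Perm (Fin n),
      coeffC t p σ * ∏ k : Fin n, Complex.exp (Complex.I * p (σ k) * (position ε h k : ℂ))
  else 0

open Classical in
/-- The candidate eigenvalue `Λ_{n,N}(t)[p_1, …, p_n]`, for `p_1 < ⋯ < p_n`. When some `p_l`
vanishes, such an `l` is unique, so that the indices `k` with `p_k ≠ 0` are the `k ≠ l`. -/
noncomputable def betheEigenvalue {n : ℕ} (t : ℝ) (N : ℕ) (p : Fin n → ℝ) : ℂ :=
  if ∀ j, p j ≠ 0 then
    ∏ k, L t (Complex.exp (Complex.I * p k)) + ∏ k, M t (Complex.exp (Complex.I * p k))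
  else
    ((2 + t ^ 2 * ((N : ℝ) - 1)
        + t ^ 2 * ∑ k ∈ Finset.univ.filter (fun k => p k ≠ 0),
            deriv (fun x => Theta t x (p k)) 0 : ℝ) : ℂ) *
      ∏ k ∈ Finset.univ.filter (fun k => p k ≠ 0), M t (Complex.exp (Complex.I * p k))

/-- The Bethe equations `N p_j = 2πj - (n+1)π - ∑_k Θ_t(p_j, p_k)`, `1 ≤ j ≤ n` (the index
`j : Fin n` being zero-based). -/
def BetheEquations {n : ℕ} (t : ℝ) (N : ℕ) (p : Fin n → ℝ) : Prop :=
  ∀ j : Fin n, (N : ℝ) * p j =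
    2 * Real.pi * ((j : ℕ) + 1 : ℝ) - ((n : ℝ) + 1) * Real.pi - ∑ k, Theta t (p j) (p k)

end SquareIce

namespace SquareIce

/-! ## Words, monomials and open rows -/

/-! Cut the cylinder at its seam: the transfer matrix becomes a sum, over the state of the seam
edge, of partition functions of open rows with equal ends (`transferMatrix_mulVec`). Against a plane
wave `∏ a_k ^ q_k` such a row is summed cell by cell from west to east. A curve may go straight up
or move to a later column, and the latter gives a geometric series in its variable. The lower end of
the series, together with the straight motion, gives a factor `L`; the upper end, together with
landing below the turn of the next curve, gives `M`. `ladder` records the result, its first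
component belonging to an occupied east edge and its second to an empty one. This is exact only up
to collision terms, equal to `M u * L v - 1` times a factor symmetric in two consecutive variables
`u`, `v`. Since `M u * L v - 1` is proportional to `pairFactor t v u`, the coefficients of the Bethe
vector are such that exchanging `u` and `v` reverses the sign of these terms (`exchange_coeff`), so
they vanish in the sum over permutations (`sum_mul_openSum`). What remains is `∏ L` times the vector
minus boundary terms for the empty seam, and `∏ M` times the vector plus boundary terms for the
occupied seam. A cyclic shift of the permutation matches the two families, and the Bethe equations
say exactly that this shift multiplies a coefficient by `z ^ N`, where `z` is the variable of the
last curve (`coeff_mul_cyc_of_bethe`). For nonzero momenta the boundary terms cancel. If `p l = 0`,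
then `L` and `M` have a pole at `exp (i p l) = 1`. That momentum is moved to `x`, the identities are
used without the Bethe equations, and `x` tends to `0`. The poles of the two products cancel because
the remaining products coincide (`prod_L_eq_prod_M`). The defect of the Bethe equation at `x` is of
first order, so against the pole of `L` it leaves a finite term, computed by `tendsto_bethe_defect`
and `sum_residue`. -/

lemma card_ones_succ {N : ℕ} (ε : Word (N + 1)) :
    (ones ε).card = (ones fun i : Fin N => ε i.castSucc).card
      + if ε (Fin.last N) = true then 1 else 0 := by
  simp only [ones, Finset.card_filter, Fin.sum_univ_castSucc]

/-- The number of letters `1` of `η` before the position `i`. -/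
def rank {N : ℕ} (η : Word N) (i : Fin N) : ℕ := ((ones η).filter (· < i)).card

/-- The monomial `∏ a_k ^ q_k[η]`. -/
noncomputable def monomial (a : ℕ → ℂ) {N : ℕ} (η : Word N) : ℂ :=
  ∏ i : Fin N, if η i = true then a (rank η i) ^ ((i : ℕ) + 1) else 1

lemma rank_castSucc {N : ℕ} (η : Word (N + 1)) (i : Fin N) :
    rank η i.castSucc = rank (fun i : Fin N => η i.castSucc) i := by
  have h : ¬ (Fin.last N < i.castSucc) := not_lt.2 (Fin.le_last _)
  simp only [rank, ones, Finset.filter_filter, Finset.card_filter, Fin.sum_univ_castSucc, h,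
    Fin.castSucc_lt_castSucc_iff, and_false, if_false, add_zero]

lemma rank_last {N : ℕ} (η : Word (N + 1)) :
    rank η (Fin.last N) = (ones fun i : Fin N => η i.castSucc).card := by
  simp only [rank, ones, Finset.filter_filter, Finset.card_filter, Fin.sum_univ_castSucc,
    Fin.castSucc_lt_last, lt_irrefl, and_true, and_false, if_false, add_zero]

lemma monomial_succ (a : ℕ → ℂ) {N : ℕ} (η : Word (N + 1)) :
    monomial a η = monomial a (fun i : Fin N => η i.castSucc) *
      if η (Fin.last N) = true then a (ones fun i : Fin N => η i.castSucc).card ^ (N + 1)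
      else 1 := by
  simp only [monomial, Fin.prod_univ_castSucc, rank_castSucc, rank_last, Fin.val_castSucc,
    Fin.val_last]

lemma rank_orderEmbOfFin {N n : ℕ} (η : Word N) (h : (ones η).card = n) (k : Fin n) :
    rank η ((ones η).orderEmbOfFin h k) = k := by
  have e : (ones η).filter (· < (ones η).orderEmbOfFin h k)
      = (Finset.Iio k).map ((ones η).orderEmbOfFin h).toEmbedding := by
    ext i
    simp only [Finset.mem_filter, Finset.mem_map, Finset.mem_Iio]
    constructor
    · rintro ⟨hi, hlt⟩
      rw [← Finset.mem_coe, ← Finset.range_orderEmbOfFin (ones η) h] at hi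
      obtain ⟨j, rfl⟩ := hi
      exact ⟨j, by simpa using hlt, rfl⟩
    · rintro ⟨j, hj, rfl⟩
      exact ⟨Finset.orderEmbOfFin_mem _ _ _, by simpa using hj⟩
  rw [rank, e, Finset.card_map, Fin.card_Iio]

/-- The extension by zero to `ℕ` of a finite sequence. -/
def pad {n : ℕ} (z : Fin n → ℂ) (k : ℕ) : ℂ := if h : k < n then z ⟨k, h⟩ else 0

lemma pad_val {n : ℕ} (z : Fin n → ℂ) (k : Fin n) : pad z k = z k := by simp [pad]

lemma pad_of_lt {n : ℕ} (z : Fin n → ℂ) {k : ℕ} (h : k < n) : pad z k = z ⟨k, h⟩ := by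
  simp [pad, h]

lemma prod_pow_position {N n : ℕ} (z : Fin n → ℂ) (η : Word N) (h : (ones η).card = n) :
    ∏ k : Fin n, z k ^ position η h k = monomial (pad z) η := by
  rw [monomial, ← Finset.prod_filter]
  change _ = ∏ i ∈ ones η, _
  rw [← Finset.map_orderEmbOfFin_univ (ones η) h, Finset.prod_map]
  refine Finset.prod_congr rfl fun k _ => ?_
  simp [rank_orderEmbOfFin, pad_val, position]

/-- The row `w` is open on both ends, with horizontal edge `h₀` on its west end and `h` on its
east end, and its symbols agree on their common sides. -/
def IsOpenRow : ∀ {N : ℕ}, Bool → (Fin N → Symb) → Bool → Prop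
  | 0, h₀, _, h => h₀ = h
  | N + 1, h₀, w, h =>
    IsOpenRow h₀ (fun i : Fin N => w i.castSucc) (w (Fin.last N)).west ∧ (w (Fin.last N)).east = h

lemma isOpenRow_iff {N : ℕ} (h₀ : Bool) (w : Fin (N + 1) → Symb) (h : Bool) :
    IsOpenRow h₀ w h ↔ (w 0).west = h₀ ∧
      (∀ k : Fin N, (w k.castSucc).east = (w k.succ).west) ∧ (w (Fin.last N)).east = h := by
  induction N generalizing h with
  | zero => simp [IsOpenRow, eq_comm]
  | succ N ih =>
    rw [IsOpenRow, ih, Fin.forall_fin_succ' (P := fun k : Fin (N + 1) => _)]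
    simp [and_assoc]

lemma isCylindric_iff {N : ℕ} (w : Fin (N + 1) → Symb) :
    IsCylindric w ↔ ∃ h, IsOpenRow h w h := by
  simp only [isOpenRow_iff, IsCylindric, Fin.forall_fin_succ' (P := fun k : Fin (N + 1) => _),
    finRotate_apply, Fin.coeSucc_eq_succ]
  constructor
  · rintro ⟨h1, h2⟩
    exact ⟨_, rfl, h1, by simpa using h2⟩
  · rintro ⟨h, h1, h2, h3⟩
    exact ⟨h2, by simp [h1, h3]⟩

lemma IsOpenRow.unique {N : ℕ} {w : Fin (N + 1) → Symb} {h h' : Bool}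
    (H : IsOpenRow h w h) (H' : IsOpenRow h' w h') : h = h' := by
  rw [isOpenRow_iff] at H H'
  exact H.1.symm.trans H'.1

/-- Conservation of the curves. -/
lemma IsOpenRow.card_north {N : ℕ} {w : Fin N → Symb} {h₀ h : Bool} (H : IsOpenRow h₀ w h) :
    (ones fun k => (w k).north).card + h.toNat = (ones fun k => (w k).south).card + h₀.toNat := by
  induction N generalizing h with
  | zero => cases H; simp [ones]
  | succ N ih =>
    obtain ⟨H1, rfl⟩ := H
    have := ih H1
    rw [card_ones_succ, card_ones_succ (fun k => (w k).south)]
    generalize w (Fin.last N) = s at *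
    cases s <;> simp_all [Symb.north, Symb.south, Symb.west, Symb.east] <;> omega

lemma turnCount_succ {N : ℕ} (w : Fin (N + 1) → Symb) :
    turnCount w = turnCount (fun i : Fin N => w i.castSucc)
      + if w (Fin.last N) = Symb.southEast ∨ w (Fin.last N) = Symb.westNorth then 1 else 0 := by
  simp only [turnCount, Finset.card_filter, Fin.sum_univ_castSucc]

open Classical in
/-- The partition function of the open rows with south sides `ε`, west end `h₀` and east end `h`,
weighted by the monomial of their north sides. -/
noncomputable def openSum (t : ℝ) (a : ℕ → ℂ) {N : ℕ} (ε : Word N) (h₀ h : Bool) : ℂ :=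
  ∑ w : Fin N → Symb, if IsOpenRow h₀ w h ∧ (fun k => (w k).south) = ε then
    (t : ℂ) ^ turnCount w * monomial a (fun k => (w k).north) else 0

lemma sum_snoc {α β : Type*} [Fintype α] [AddCommMonoid β] {N : ℕ}
    (f : (Fin (N + 1) → α) → β) :
    ∑ w, f w = ∑ s : α, ∑ w : Fin N → α, f (Fin.snoc w s : Fin (N + 1) → α) := by
  rw [← Fintype.sum_prod_type', ← (Fin.snocEquiv fun _ => α).sum_comp]
  rfl

open Classical in
-- Conservation of the curves fixes the number of north exits before the last cell, hence which
-- variable that cell carries. The truncated subtraction is exact whenever the inner partition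
-- function has a contributing row.
lemma openSum_succ (t : ℝ) (a : ℕ → ℂ) {N : ℕ} (ε : Word (N + 1)) (h₀ h : Bool) :
    openSum t a ε h₀ h = ∑ s : Symb, if s.east = h ∧ s.south = ε (Fin.last N) then
      (if s = Symb.southEast ∨ s = Symb.westNorth then (t : ℂ) else 1) *
      (if s.north = true then
        a ((ones fun i : Fin N => ε i.castSucc).card + h₀.toNat - s.west.toNat) ^ (N + 1) else 1) *
      openSum t a (fun i : Fin N => ε i.castSucc) h₀ s.west else 0 := by
  rw [openSum, sum_snoc]
  refine Finset.sum_congr rfl fun s _ => ?_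
  have hs : ∀ w : Fin N → Symb, (fun k => (Fin.snoc w s : Fin (N + 1) → Symb) k |>.south) = ε ↔
      (fun k => (w k).south) = (fun i : Fin N => ε i.castSucc) ∧ s.south = ε (Fin.last N) := by
    intro w
    simp [funext_iff, Fin.forall_fin_succ' (P := fun k : Fin (N + 1) => _)]
  simp only [openSum, IsOpenRow, hs, Fin.snoc_castSucc, Fin.snoc_last, turnCount_succ,
    monomial_succ, Finset.mul_sum]
  by_cases h1 : s.east = h ∧ s.south = ε (Fin.last N)
  · rw [if_pos h1]
    refine Finset.sum_congr rfl fun w _ => ?_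
    by_cases h2 : IsOpenRow h₀ w s.west ∧ (fun k => (w k).south) = (fun i : Fin N => ε i.castSucc)
    · have h3 := h2.1.card_north
      rw [h2.2] at h3
      rw [if_pos ⟨⟨h2.1, h1.1⟩, h2.2, h1.2⟩, if_pos h2, ← h3, Nat.add_sub_cancel]
      split_ifs <;> ring
    · rw [if_neg (fun h3 => h2 ⟨h3.1.1, h3.2.1⟩), if_neg h2, mul_zero]
  · rw [if_neg h1]
    refine Finset.sum_eq_zero fun w _ => if_neg fun h3 => h1 ⟨h3.1.2, h3.2.2⟩

lemma sum_symb {β : Type*} [AddCommMonoid β] (f : Symb → β) :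
    ∑ s, f s = f .empty + f .vertical + f .southEast + f .westNorth + f .double
      + f .horizontal := by
  change ∑ s ∈ ({.empty, .vertical, .southEast, .westNorth, .double, .horizontal} : Finset Symb),
    f s = _
  simp [add_assoc]

/-! ### One-cell recursions for open rows -/

lemma openSum_false_of_false (t : ℝ) (a : ℕ → ℂ) {N : ℕ} (ε : Word (N + 1)) (h₀ : Bool)
    (hε : ε (Fin.last N) = false) :
    openSum t a ε h₀ false = openSum t a (fun i : Fin N => ε i.castSucc) h₀ false
      + t * a ((ones fun i : Fin N => ε i.castSucc).card + h₀.toNat - 1) ^ (N + 1)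
        * openSum t a (fun i : Fin N => ε i.castSucc) h₀ true := by
  rw [openSum_succ, sum_symb]
  simp [hε, Symb.east, Symb.south, Symb.north, Symb.west]

lemma openSum_true_of_false (t : ℝ) (a : ℕ → ℂ) {N : ℕ} (ε : Word (N + 1)) (h₀ : Bool)
    (hε : ε (Fin.last N) = false) :
    openSum t a ε h₀ true = openSum t a (fun i : Fin N => ε i.castSucc) h₀ true := by
  rw [openSum_succ, sum_symb]
  simp [hε, Symb.east, Symb.south, Symb.north, Symb.west]

lemma openSum_false_of_true (t : ℝ) (a : ℕ → ℂ) {N : ℕ} (ε : Word (N + 1)) (h₀ : Bool)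
    (hε : ε (Fin.last N) = true) :
    openSum t a ε h₀ false =
      a ((ones fun i : Fin N => ε i.castSucc).card + h₀.toNat) ^ (N + 1)
        * openSum t a (fun i : Fin N => ε i.castSucc) h₀ false := by
  rw [openSum_succ, sum_symb]
  simp [hε, Symb.east, Symb.south, Symb.north, Symb.west]

lemma openSum_true_of_true (t : ℝ) (a : ℕ → ℂ) {N : ℕ} (ε : Word (N + 1)) (h₀ : Bool)
    (hε : ε (Fin.last N) = true) :
    openSum t a ε h₀ true = t * openSum t a (fun i : Fin N => ε i.castSucc) h₀ false
      + a ((ones fun i : Fin N => ε i.castSucc).card + h₀.toNat - 1) ^ (N + 1)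
        * openSum t a (fun i : Fin N => ε i.castSucc) h₀ true := by
  rw [openSum_succ, sum_symb]
  simp [hε, Symb.east, Symb.south, Symb.north, Symb.west]

lemma openSum_zero (t : ℝ) (a : ℕ → ℂ) (ε : Word 0) (h₀ h : Bool) :
    openSum t a ε h₀ h = if h₀ = h then 1 else 0 := by
  have : ∀ w : Fin 0 → Symb, (fun k => (w k).south) = ε := fun w => Subsingleton.elim _ _
  simp [openSum, IsOpenRow, this, turnCount, monomial]

/-! ## The action of the transfer matrix on Bethe vectors -/

/-- A nonempty cylindric row has exactly one seam state, so summing over that state counts each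
pattern once. -/
lemma transferMatrix_mulVec {N : ℕ} (t : ℝ) (v : Word (N + 1) → ℂ) (ε : Word (N + 1)) :
    (transferMatrix (N + 1) t).mulVec v ε = ∑ h : Bool, ∑ w : Fin (N + 1) → Symb,
      open Classical in if IsOpenRow h w h ∧ (fun k => (w k).south) = ε then
        (t : ℂ) ^ turnCount w * v (fun k => (w k).north) else 0 := by
  classical
  simp only [Matrix.mulVec, dotProduct, transferMatrix, Matrix.of_apply, Finset.sum_filter,
    Finset.sum_mul]
  rw [Finset.sum_comm, Finset.sum_comm (γ := Bool)]
  refine Finset.sum_congr rfl fun w _ => ?_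
  -- The row determines its north word, so only one `η` contributes.
  rw [Finset.sum_eq_single (fun k => (w k).north)]
  · have hL : Links ε w (fun k => (w k).north) ↔ (fun k => (w k).south) = ε := by
      simp [Links, funext_iff]
    rw [hL, isCylindric_iff]
    by_cases hs : (fun k => (w k).south) = ε
    · by_cases hc : ∃ h, IsOpenRow h w h
      · obtain ⟨h, hh⟩ := hc
        rw [if_pos ⟨⟨h, hh⟩, hs⟩, Finset.sum_eq_single h, if_pos ⟨hh, hs⟩]
        · intro b _ hb
          exact if_neg fun hb' => hb (hb'.1.unique hh)
        · simp
      · rw [if_neg fun h => hc h.1, Finset.sum_eq_zero, zero_mul]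
        exact fun b _ => if_neg fun hb => hc ⟨b, hb.1⟩
    · simp [hs]
  · intro η _ hη
    rw [if_neg, zero_mul]
    exact fun h => hη (funext fun k => (h.2.2 k).symm)
  · simp

/-- The vector `ψ` written with monomials. -/
lemma betheVector_eq {n : ℕ} (t : ℝ) (N : ℕ) (p : Fin n → ℝ) (ε : Word N) :
    betheVector t N p ε = if (ones ε).card = n then ∑ σ : Equiv.Perm (Fin n), coeffC t p σ *
      monomial (pad fun k => Complex.exp (Complex.I * p (σ k))) ε else 0 := by
  unfold betheVector
  split_ifs with h
  · refine Finset.sum_congr rfl fun σ _ => ?_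
    rw [← prod_pow_position _ _ h]
    simp only [← Complex.exp_nat_mul]
    congr 1
    refine Finset.prod_congr rfl fun k _ => ?_
    ring_nf
  · rfl

lemma transferMatrix_mulVec_betheVector_of_ne {n N : ℕ} (t : ℝ) (p : Fin n → ℝ)
    (ε : Word (N + 1)) (h : (ones ε).card ≠ n) :
    (transferMatrix (N + 1) t).mulVec (betheVector t (N + 1) p) ε = 0 := by
  rw [transferMatrix_mulVec]
  refine Finset.sum_eq_zero fun b _ => Finset.sum_eq_zero fun w _ => ?_
  split_ifs with hw
  · have := hw.1.card_north
    rw [hw.2, Nat.add_right_cancel_iff] at this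
    rw [betheVector_eq, if_neg (this ▸ h), mul_zero]
  · rfl

lemma transferMatrix_mulVec_betheVector {n N : ℕ} (t : ℝ) (p : Fin n → ℝ)
    (ε : Word (N + 1)) (h : (ones ε).card = n) :
    (transferMatrix (N + 1) t).mulVec (betheVector t (N + 1) p) ε =
      ∑ σ : Equiv.Perm (Fin n), coeffC t p σ *
        (openSum t (pad fun k => Complex.exp (Complex.I * p (σ k))) ε false false +
          openSum t (pad fun k => Complex.exp (Complex.I * p (σ k))) ε true true) := by
  classical
  have key : ∀ b : Bool, (∑ w : Fin (N + 1) → Symb,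
      if IsOpenRow b w b ∧ (fun k => (w k).south) = ε then
        (t : ℂ) ^ turnCount w * betheVector t (N + 1) p (fun k => (w k).north) else 0) =
      ∑ σ : Equiv.Perm (Fin n), coeffC t p σ *
        openSum t (pad fun k => Complex.exp (Complex.I * p (σ k))) ε b b := by
    intro b
    simp only [openSum, Finset.mul_sum]
    rw [Finset.sum_comm]
    refine Finset.sum_congr rfl fun w _ => ?_
    split_ifs with hw
    · have := hw.1.card_north
      rw [hw.2, Nat.add_right_cancel_iff] at this
      rw [betheVector_eq, if_pos (this.trans h), Finset.mul_sum]
      exact Finset.sum_congr rfl fun σ _ => by ring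
    · simp
  rw [transferMatrix_mulVec, Fintype.sum_bool, add_comm]
  simp only [mul_add, Finset.sum_add_distrib]
  convert congrArg₂ (· + ·) (key false) (key true) using 1

/-! ## Antisymmetrized partition functions -/

lemma M_sub_one_mul (t : ℝ) (z : ℂ) : (M t z - 1) * z = -(L t z - 1) := by
  unfold M L; ring

lemma M_sub_one_mul_one_sub (t : ℝ) {z : ℂ} (hz : z ≠ 1) :
    (M t z - 1) * (1 - z) = -(t : ℂ) ^ 2 := by
  have : 1 - z ≠ 0 := sub_ne_zero.2 hz.symm
  unfold M; field_simp; ring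

/-- The recursion satisfied, up to antisymmetrization, by the partition functions of open rows. -/
noncomputable def ladder (t : ℝ) (b : Bool) (a : ℕ → ℂ) : ∀ {N : ℕ}, Word N → ℂ × ℂ
  | 0, _ => if b then (1, L t (a 0) - 1) else (0, 1)
  | N + 1, ε =>
    let ε' : Word N := fun i => ε i.castSucc
    let c := (ones ε').card + b.toNat
    if ε (Fin.last N) = true then
      ((ladder t b a ε').2 + (ladder t b a ε').1 * M t (a (c - 1)) * a (c - 1) ^ (N + 1),
        (ladder t b a ε').2 * L t (a c) * a c ^ (N + 1))
    else ladder t b a ε'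

lemma ladder_of_false (t : ℝ) (b : Bool) (a : ℕ → ℂ) {N : ℕ} (ε : Word (N + 1))
    (hε : ε (Fin.last N) = false) :
    ladder t b a ε = ladder t b a (fun i : Fin N => ε i.castSucc) := by
  simp [ladder, hε]

lemma ladder_of_true (t : ℝ) (b : Bool) (a : ℕ → ℂ) {N : ℕ} (ε : Word (N + 1)) {c : ℕ}
    (hc : (ones fun i : Fin N => ε i.castSucc).card + b.toNat = c)
    (hε : ε (Fin.last N) = true) :
    ladder t b a ε = ((ladder t b a (fun i : Fin N => ε i.castSucc)).2 +
        (ladder t b a (fun i : Fin N => ε i.castSucc)).1 * M t (a (c - 1)) * a (c - 1) ^ (N + 1),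
      (ladder t b a (fun i : Fin N => ε i.castSucc)).2 * L t (a c) * a c ^ (N + 1)) := by
  simp [ladder, hε, hc]

/-- With an empty west end and no south entry, no curve can occupy the east edge. This makes the
truncated index `c - 1` harmless when `c = 0`. -/
lemma ladder_fst_eq_zero (t : ℝ) (a : ℕ → ℂ) {N : ℕ} (ε : Word N) (h : (ones ε).card = 0) :
    (ladder t false a ε).1 = 0 := by
  induction N with
  | zero => simp [ladder]
  | succ N ih =>
    rw [card_ones_succ, Nat.add_eq_zero_iff] at h
    have h2 : ε (Fin.last N) = false := by simpa using h.2
    rw [ladder_of_false _ _ _ _ h2, ih _ h.1]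

/-- The first component ignores the variable of the curve still travelling on the east edge. Hence
it is unchanged when that variable is swapped with the next one. -/
lemma ladder_congr (t : ℝ) (b : Bool) {a a' : ℕ → ℂ} {N : ℕ} (ε : Word N) :
    ((∀ k, k + 1 < (ones ε).card + b.toNat → a k = a' k) →
      (ladder t b a ε).1 = (ladder t b a' ε).1) ∧
    ((∀ k, k < (ones ε).card + b.toNat → a k = a' k) →
      (ladder t b a ε).2 = (ladder t b a' ε).2) := by
  induction N with
  | zero =>
    cases b
    · simp [ladder]
    · refine ⟨fun _ => by simp [ladder], fun h => ?_⟩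
      simp [ladder, h 0 (by simp)]
  | succ N ih =>
    cases hε : ε (Fin.last N)
    · simp only [card_ones_succ, hε, ladder_of_false _ _ _ _ hε]
      simpa using ih _
    · obtain ⟨c, hc⟩ : ∃ c, (ones fun i : Fin N => ε i.castSucc).card + b.toNat = c := ⟨_, rfl⟩
      have hc' : (ones ε).card + b.toNat = c + 1 := by
        rw [card_ones_succ, hε, ← hc]; simp; ring
      have ih := ih (fun i : Fin N => ε i.castSucc)
      rw [hc] at ih
      rw [ladder_of_true _ _ _ _ hc hε, ladder_of_true _ _ _ _ hc hε, hc']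
      constructor
      · intro h
        have h2 := ih.2 fun k hk => h k (by omega)
        have h1 := ih.1 fun k hk => h k (by omega)
        simp only [h2, h1]
        rcases Nat.eq_zero_or_pos c with h0 | h0
        · have hb : b = false := by cases b <;> simp_all
          subst hb
          have := ladder_fst_eq_zero t a' (fun i : Fin N => ε i.castSucc) (by simpa [h0] using hc)
          simp [this]
        · rw [h (c - 1) (by omega)]
      · intro h
        have h2 := ih.2 fun k hk => h k (by omega)
        simp only [h2, h c (by omega)]

/-- The relation between the coefficients of two permutations which differ by the transposition
of the consecutive positions `k, k + 1`, for `k + 1 < m`. -/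
def Exchange {n : ℕ} (t : ℝ) (z : Fin n → ℂ) (m : ℕ) (A : Equiv.Perm (Fin n) → ℂ) : Prop :=
  ∀ (k : ℕ) (h : k + 1 < n), k + 1 < m → ∀ σ : Equiv.Perm (Fin n),
    A σ * (M t (z (σ ⟨k, by omega⟩)) * L t (z (σ ⟨k + 1, h⟩)) - 1) +
      A (σ * Equiv.swap ⟨k, by omega⟩ ⟨k + 1, h⟩) *
        (M t (z (σ ⟨k + 1, h⟩)) * L t (z (σ ⟨k, by omega⟩)) - 1) = 0

lemma pad_mul_swap {n : ℕ} (z : Fin n → ℂ) (σ : Equiv.Perm (Fin n)) (i j : Fin n) {k : ℕ}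
    (hi : k ≠ i) (hj : k ≠ j) :
    pad (fun l => z ((σ * Equiv.swap i j) l)) k = pad (fun l => z (σ l)) k := by
  unfold pad
  split_ifs with h
  · dsimp only
    rw [Equiv.Perm.mul_apply, Equiv.swap_apply_of_ne_of_ne] <;> simpa [Fin.ext_iff]
  · rfl

lemma Exchange.mono {n : ℕ} {t : ℝ} {z : Fin n → ℂ} {m m' : ℕ} {A : Equiv.Perm (Fin n) → ℂ}
    (h : Exchange t z m A) (hm : m' ≤ m) : Exchange t z m' A :=
  fun k hk hk' => h k hk (hk'.trans_le hm)

lemma Exchange.mul {n : ℕ} {t : ℝ} {z : Fin n → ℂ} {m : ℕ} {A B : Equiv.Perm (Fin n) → ℂ}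
    (h : Exchange t z m A)
    (hB : ∀ (k : ℕ) (h : k + 1 < n), k + 1 < m → ∀ σ : Equiv.Perm (Fin n),
      B (σ * Equiv.swap ⟨k, by omega⟩ ⟨k + 1, h⟩) = B σ) :
    Exchange t z m (fun σ => A σ * B σ) := by
  intro k hk hkm σ
  dsimp only
  rw [hB k hk hkm]
  linear_combination B σ * h k hk hkm σ

lemma Exchange.mul_pad {n : ℕ} {t : ℝ} {z : Fin n → ℂ} {m : ℕ} {A : Equiv.Perm (Fin n) → ℂ}
    (h : Exchange t z m A) (g : ℂ → ℂ) {j : ℕ} (hj : m ≤ j) :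
    Exchange t z m (fun σ => A σ * g (pad (fun l => z (σ l)) j)) := by
  refine h.mul fun k hk hkm σ => ?_
  rw [pad_mul_swap] <;> simp <;> omega

/-- The terms of `σ` and of `σ` followed by the transposition of positions are opposite, by the
exchange relation. -/
lemma Exchange.sum_eq_zero {n : ℕ} {t : ℝ} {z : Fin n → ℂ} {m : ℕ}
    {A B : Equiv.Perm (Fin n) → ℂ} (h : Exchange t z m A) (k : ℕ) (hk : k + 1 < n)
    (hkm : k + 1 < m)
    (hB : ∀ σ : Equiv.Perm (Fin n), B (σ * Equiv.swap ⟨k, by omega⟩ ⟨k + 1, hk⟩) = B σ) :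
    ∑ σ, A σ * ((M t (z (σ ⟨k, by omega⟩)) * L t (z (σ ⟨k + 1, hk⟩)) - 1) * B σ) = 0 := by
  set s : Equiv.Perm (Fin n) := Equiv.swap ⟨k, by omega⟩ ⟨k + 1, hk⟩ with hs
  set f : Equiv.Perm (Fin n) → ℂ := fun σ =>
    A σ * ((M t (z (σ ⟨k, by omega⟩)) * L t (z (σ ⟨k + 1, hk⟩)) - 1) * B σ) with hf
  have e : ∑ σ, f (σ * s) = ∑ σ, f σ := Equiv.sum_comp (Equiv.mulRight s) f
  have h0 : ∑ σ, (f σ + f (σ * s)) = 0 := by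
    refine Finset.sum_eq_zero fun σ _ => ?_
    have := h k hk hkm σ
    have hBσ := hB σ
    rw [hs] at hBσ
    simp only [hf, hs, hBσ]
    simp only [Equiv.Perm.mul_apply, Equiv.swap_apply_left, Equiv.swap_apply_right]
    linear_combination B σ * this
  rw [Finset.sum_add_distrib, e] at h0
  exact add_self_eq_zero.1 h0

/-- With an empty east end, the term in `M - 1` is the upper end of the geometric series of the last
curve, stopped at column `N`. Induction on `N` extends this series or starts a new one; antisymmetry
is used only when a curve arrives from the south. -/
lemma sum_mul_openSum {n : ℕ} (t : ℝ) (z : Fin n → ℂ) (hz : ∀ k, z k ≠ 1) (b : Bool) {N : ℕ}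
    (ε : Word N) :
    ((ones ε).card + b.toNat ≤ n → ∀ A, Exchange t z ((ones ε).card + b.toNat) A →
      ∑ σ, A σ * ((if b then (t : ℂ) else 1) * openSum t (pad fun k => z (σ k)) ε b false) =
      ∑ σ, A σ * ((ladder t b (pad fun k => z (σ k)) ε).2 +
        (M t (pad (fun k => z (σ k)) ((ones ε).card + b.toNat - 1)) - 1) *
          pad (fun k => z (σ k)) ((ones ε).card + b.toNat - 1) ^ (N + 1) *
          (ladder t b (pad fun k => z (σ k)) ε).1)) ∧
    ((ones ε).card + b.toNat ≤ n + 1 → ∀ A, Exchange t z ((ones ε).card + b.toNat - 1) A →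
      ∑ σ, A σ * ((if b then (t : ℂ) else 1) * openSum t (pad fun k => z (σ k)) ε b true) =
      ∑ σ, A σ * (t * (ladder t b (pad fun k => z (σ k)) ε).1)) := by
  have hpad : ∀ (σ : Equiv.Perm (Fin n)) k, pad (fun k => z (σ k)) k ≠ 1 := by
    intro σ k
    unfold pad
    split_ifs
    · exact hz _
    · exact zero_ne_one
  induction N with
  | zero =>
    have h0 : (ones ε).card = 0 := by simp [ones]
    cases b
    · simp [openSum_zero, ladder]
    · simp only [h0, openSum_zero, ladder]
      refine ⟨fun _ A _ => Finset.sum_congr rfl fun σ _ => ?_, by simp⟩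
      -- The initial value `L - 1` is the one that cancels the upper end of a series with no term
      -- yet.
      have := M_sub_one_mul t (pad (fun k => z (σ k)) 0)
      simp only [Bool.toNat_true, zero_add, Nat.sub_self, pow_one, if_true, this]
      simp
  | succ N ih =>
    obtain ⟨c, hc⟩ : ∃ c, (ones fun i : Fin N => ε i.castSucc).card + b.toNat = c := ⟨_, rfl⟩
    obtain ⟨ih0, ih1⟩ := ih (fun i : Fin N => ε i.castSucc)
    rw [hc] at ih0 ih1
    cases hε : ε (Fin.last N)
    · have hc' : (ones ε).card + b.toNat = c := by rw [card_ones_succ, hε, ← hc]; simp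
      simp only [hc', openSum_false_of_false _ _ _ _ hε, openSum_true_of_false _ _ _ _ hε,
        ladder_of_false _ _ _ _ hε, hc]
      refine ⟨fun hcn A hA => ?_, ih1⟩
      have e0 := ih0 hcn A hA
      have e1 := ih1 (by omega) _ ((hA.mono (Nat.sub_le c 1)).mul_pad (fun w => t * w ^ (N + 1))
        (j := c - 1) le_rfl)
      simp only [mul_add, Finset.sum_add_distrib] at e0 e1 ⊢
      rw [e0, add_assoc]
      congr 1
      have e2 := congrArg₂ (· + ·) (Eq.refl (∑ σ, A σ *
        ((M t (pad (fun k => z (σ k)) (c - 1)) - 1) * pad (fun k => z (σ k)) (c - 1) ^ (N + 1) *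
          (ladder t b (pad fun k => z (σ k)) fun i : Fin N => ε i.castSucc).1))) e1
      convert e2 using 1
      · congr 1
        exact Finset.sum_congr rfl fun σ _ => by ring
      · rw [← Finset.sum_add_distrib]
        refine Finset.sum_congr rfl fun σ _ => ?_
        -- The geometric series gains one term: its upper end advances from power `N + 1` to `N +
        -- 2`.
        have := M_sub_one_mul_one_sub t (hpad σ (c - 1))
        rw [pow_succ _ (N + 1)]
        linear_combination (-A σ * (ladder t b (pad fun k => z (σ k))
          fun i : Fin N => ε i.castSucc).1 * pad (fun k => z (σ k)) (c - 1) ^ (N + 1)) * this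
    · have hc' : (ones ε).card + b.toNat = c + 1 := by
        rw [card_ones_succ, hε, ← hc]; simp; ring
      simp only [hc', openSum_false_of_true _ _ _ _ hε, openSum_true_of_true _ _ _ _ hε,
        ladder_of_true _ _ _ _ hc hε, hc, Nat.add_sub_cancel]
      constructor
      · intro hcn A hA
        have e0 := ih0 (by omega) _ ((hA.mono (Nat.le_succ c)).mul_pad (fun w => w ^ (N + 1))
          (j := c) le_rfl)
        have e0' : ∑ σ, A σ * ((if b then (t : ℂ) else 1) * (pad (fun k => z (σ k)) c ^ (N + 1) *
            openSum t (pad fun k => z (σ k)) (fun i : Fin N => ε i.castSucc) b false)) = _ :=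
          (Finset.sum_congr rfl fun σ _ => by ring).trans e0
        rw [e0', ← sub_eq_zero, ← Finset.sum_sub_distrib]
        rcases Nat.eq_zero_or_pos c with h0 | h0
        · have hb : b = false := by cases b <;> simp_all
          subst hb
          refine Finset.sum_eq_zero fun σ _ => ?_
          rw [ladder_fst_eq_zero t _ (fun i : Fin N => ε i.castSucc) (by simpa [h0] using hc)]
          have := M_sub_one_mul t (pad (fun k => z (σ k)) c)
          rw [pow_succ _ (N + 1)]
          linear_combination (-A σ * (ladder t false (pad fun k => z (σ k))
            fun i : Fin N => ε i.castSucc).2 * pad (fun k => z (σ k)) c ^ (N + 1)) * this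
        · obtain ⟨d, rfl⟩ : ∃ d, c = d + 1 := ⟨c - 1, by omega⟩
          have hd : d + 1 < n := by omega
          -- The discrepancy is the collision of curves `d` and `d + 1`: `M L - 1` times a factor
          -- symmetric in their variables.
          rw [← hA.sum_eq_zero (B := fun σ => (ladder t b (pad fun k => z (σ k))
            fun i : Fin N => ε i.castSucc).1 * (pad (fun k => z (σ k)) d ^ (N + 1) *
              pad (fun k => z (σ k)) (d + 1) ^ (N + 1))) d hd (by omega)]
          · refine Finset.sum_congr rfl fun σ _ => ?_
            have := M_sub_one_mul t (pad (fun k => z (σ k)) (d + 1))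
            have p1 : z (σ ⟨d, by omega⟩) = pad (fun k => z (σ k)) d :=
              (pad_of_lt (fun k => z (σ k)) _).symm
            have p2 : z (σ ⟨d + 1, hd⟩) = pad (fun k => z (σ k)) (d + 1) :=
              (pad_of_lt (fun k => z (σ k)) _).symm
            rw [p1, p2, pow_succ _ (N + 1), Nat.add_sub_cancel]
            linear_combination (-A σ * ((ladder t b (pad fun k => z (σ k))
              fun i : Fin N => ε i.castSucc).2 + (ladder t b (pad fun k => z (σ k))
              fun i : Fin N => ε i.castSucc).1 * M t (pad (fun k => z (σ k)) d) *
              pad (fun k => z (σ k)) d ^ (N + 1)) * pad (fun k => z (σ k)) (d + 1) ^ (N + 1)) * this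
          · intro σ
            congr 1
            · refine (ladder_congr t b _).1 fun k hk => pad_mul_swap _ _ _ _ ?_ ?_ <;> simp <;> omega
            · rw [pad_of_lt _ hd, pad_of_lt _ hd, pad_of_lt _ (show d < n by omega),
                pad_of_lt _ (show d < n by omega), mul_comm]
              simp
      · intro hcn A hA
        have e0 := ih0 (by omega) A hA
        have e1 := ih1 (by omega) _ ((hA.mono (Nat.sub_le c 1)).mul_pad (fun w => w ^ (N + 1))
          (j := c - 1) le_rfl)
        have e2 := congrArg₂ (fun x y : ℂ => t * x + y) e0 e1
        simp only [Finset.mul_sum, ← Finset.sum_add_distrib] at e2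
        convert e2 using 1 <;> exact Finset.sum_congr rfl fun σ _ => by ring

lemma ladder_false_snd (t : ℝ) (a : ℕ → ℂ) {N : ℕ} (ε : Word N) :
    (ladder t false a ε).2 = (∏ k ∈ Finset.range (ones ε).card, L t (a k)) * monomial a ε := by
  induction N with
  | zero => simp [ladder, ones, monomial]
  | succ N ih =>
    rw [monomial_succ, card_ones_succ]
    cases hε : ε (Fin.last N)
    · simp [ladder_of_false _ _ _ _ hε, ih]
    · rw [ladder_of_true _ _ _ _ rfl hε, ih]
      simp [Finset.prod_range_succ]
      ring

/-- The recursion is linear and its initial value is `(1, 0) + (L - 1) • (0, 1)`. Starting from `(1,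
0)` every curve yields a factor `M`; starting from `(0, 1)` gives the ladder of the empty seam with
variables shifted by one. -/
lemma ladder_true (t : ℝ) (a : ℕ → ℂ) {N : ℕ} (ε : Word N) :
    (ladder t true a ε).2 = (L t (a 0) - 1) * (ladder t false (fun k => a (k + 1)) ε).2 ∧
    (ladder t true a ε).1 = (∏ k ∈ Finset.range (ones ε).card, M t (a k)) * monomial a ε +
      (L t (a 0) - 1) * (ladder t false (fun k => a (k + 1)) ε).1 := by
  induction N with
  | zero => simp [ladder, ones, monomial]
  | succ N ih =>
    obtain ⟨ih2, ih1⟩ := ih (fun i : Fin N => ε i.castSucc)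
    rw [monomial_succ, card_ones_succ]
    cases hε : ε (Fin.last N)
    · simp [ladder_of_false _ _ _ _ hε, ih1, ih2]
    · rw [ladder_of_true _ _ _ _ rfl hε, ladder_of_true _ _ _ _ rfl hε, ih1, ih2]
      simp only [Bool.toNat_true, Bool.toNat_false, add_zero, Nat.add_sub_cancel, if_true,
        Finset.prod_range_succ]
      refine ⟨by ring, ?_⟩
      rcases Nat.eq_zero_or_pos (ones fun i : Fin N => ε i.castSucc).card with h0 | h0
      · rw [ladder_fst_eq_zero t _ _ h0]; ring
      · rw [Nat.sub_add_cancel h0]; ring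

/-! ## The coefficients of the Bethe vector -/

/-- The factor of a pair in the coefficients of the Bethe vector. -/
noncomputable def pairFactor (t : ℝ) (u v : ℂ) : ℂ := 1 + u * v - 2 * (Delta t : ℂ) * u

/-- The coefficients of the Bethe vector as functions of `z_k = exp (i p_k)`. -/
noncomputable def coeff {n : ℕ} (t : ℝ) (z : Fin n → ℂ) (σ : Equiv.Perm (Fin n)) : ℂ :=
  ((Equiv.Perm.sign σ : ℤ) : ℂ) * ∏ k, ∏ l ∈ Finset.Ioi k, pairFactor t (z (σ k)) (z (σ l))

lemma exp_mul_eq_pairFactor (t x y : ℝ) :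
    Complex.exp (Complex.I * x) * (Complex.exp (-Complex.I * x) + Complex.exp (Complex.I * y)
      - 2 * (Delta t : ℂ)) =
    pairFactor t (Complex.exp (Complex.I * x)) (Complex.exp (Complex.I * y)) := by
  have : Complex.exp (Complex.I * x) * Complex.exp (-Complex.I * x) = 1 := by
    rw [← Complex.exp_add]; simp
  unfold pairFactor
  linear_combination this

lemma coeffC_eq {n : ℕ} (t : ℝ) (p : Fin n → ℝ) (σ : Equiv.Perm (Fin n)) :
    coeffC t p σ = coeff t (fun k => Complex.exp (Complex.I * p k)) σ := by
  simp only [coeffC, coeff, exp_mul_eq_pairFactor]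

lemma prod_pairs_eq {n : ℕ} (f : Fin n → Fin n → ℂ) {i j : Fin n} (hij : (i : ℕ) + 1 = j) :
    ∏ k, ∏ l ∈ Finset.Ioi k, f k l = f i j *
      ∏ q ∈ (Finset.univ : Finset (Fin n × Fin n)).filter (fun q => q.1 < q.2 ∧ q ≠ (i, j)),
        f q.1 q.2 := by
  have h1 : ∏ k, ∏ l ∈ Finset.Ioi k, f k l =
      ∏ q ∈ (Finset.univ : Finset (Fin n × Fin n)).filter (fun q => q.1 < q.2), f q.1 q.2 := by
    rw [Finset.prod_filter, Fintype.prod_prod_type]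
    refine Finset.prod_congr rfl fun k _ => ?_
    rw [← Finset.prod_filter]
    refine Finset.prod_congr ?_ fun _ _ => rfl
    ext; simp
  rw [h1, ← Finset.mul_prod_erase _ _ (a := (i, j)) (by
    rw [Finset.mem_filter, Fin.lt_def]; exact ⟨Finset.mem_univ _, by simp only; omega⟩)]
  congr 1
  refine Finset.prod_congr ?_ fun _ _ => rfl
  ext; simp [and_comm]

/-- No index lies between `i` and `j`, so their transposition permutes the other increasing pairs.
-/
lemma prod_pairs_mul_swap {n : ℕ} (f : Fin n → Fin n → ℂ) (σ : Equiv.Perm (Fin n)) {i j : Fin n}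
    (hij : (i : ℕ) + 1 = j) :
    ∏ q ∈ (Finset.univ : Finset (Fin n × Fin n)).filter (fun q => q.1 < q.2 ∧ q ≠ (i, j)),
        f ((σ * Equiv.swap i j) q.1) ((σ * Equiv.swap i j) q.2) =
      ∏ q ∈ (Finset.univ : Finset (Fin n × Fin n)).filter (fun q => q.1 < q.2 ∧ q ≠ (i, j)),
        f (σ q.1) (σ q.2) := by
  have key : ∀ q : Fin n × Fin n, q.1 < q.2 ∧ q ≠ (i, j) →
      Equiv.swap i j q.1 < Equiv.swap i j q.2 ∧
        (Equiv.swap i j q.1, Equiv.swap i j q.2) ≠ (i, j) := by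
    rintro ⟨a, b⟩ ⟨h1, h2⟩
    simp only [ne_eq, Prod.mk.injEq, Fin.ext_iff, Fin.lt_def, Equiv.swap_apply_def] at h1 h2 ⊢
    split_ifs <;> omega
  refine Finset.prod_nbij' (fun q => (Equiv.swap i j q.1, Equiv.swap i j q.2))
    (fun q => (Equiv.swap i j q.1, Equiv.swap i j q.2)) ?_ ?_ ?_ ?_ ?_
  · intro q hq
    simpa using key q (by simpa using hq)
  · intro q hq
    simpa using key q (by simpa using hq)
  · intro q _; simp
  · intro q _; simp
  · intro q _; simp

lemma L_mul_M_sub_one (t : ℝ) {u v : ℂ} (hu : u ≠ 1) (hv : v ≠ 1) :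
    (M t u * L t v - 1) * ((1 - u) * (1 - v)) = -(t : ℂ) ^ 2 * pairFactor t v u := by
  have h1 : 1 - u ≠ 0 := sub_ne_zero.2 hu.symm
  have h2 : 1 - v ≠ 0 := sub_ne_zero.2 hv.symm
  unfold M L pairFactor Delta
  push_cast
  field_simp
  ring

/-- By `L_mul_M_sub_one` each term contains both orders of `pairFactor` for the two variables, hence
is symmetric up to the sign of the permutation. -/
lemma exchange_coeff {n : ℕ} (t : ℝ) (z : Fin n → ℂ) (hz : ∀ k, z k ≠ 1) (m : ℕ) :
    Exchange t z m (coeff t z) := by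
  intro k hk _ σ
  obtain ⟨i, hi⟩ : ∃ i : Fin n, i = ⟨k, by omega⟩ := ⟨_, rfl⟩
  obtain ⟨j, hj⟩ : ∃ j : Fin n, j = ⟨k + 1, hk⟩ := ⟨_, rfl⟩
  rw [← hi, ← hj]
  have hij : (i : ℕ) + 1 = j := by rw [hi, hj]
  have hne : i ≠ j := by rw [ne_eq, Fin.ext_iff]; omega
  unfold coeff
  rw [prod_pairs_eq (fun a b => pairFactor t (z (σ a)) (z (σ b))) hij,
    prod_pairs_eq (fun a b => pairFactor t (z ((σ * Equiv.swap i j) a))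
      (z ((σ * Equiv.swap i j) b))) hij,
    prod_pairs_mul_swap (fun a b => pairFactor t (z a) (z b)) σ hij, Equiv.Perm.sign_mul,
    Equiv.Perm.sign_swap hne]
  simp only [Equiv.Perm.mul_apply, Equiv.swap_apply_left, Equiv.swap_apply_right]
  have h1 := L_mul_M_sub_one t (hz (σ i)) (hz (σ j))
  have h2 := L_mul_M_sub_one t (hz (σ j)) (hz (σ i))
  have h3 : (1 - z (σ i)) * (1 - z (σ j)) ≠ 0 :=
    mul_ne_zero (sub_ne_zero.2 (hz _).symm) (sub_ne_zero.2 (hz _).symm)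
  refine (mul_eq_zero.1 ?_).resolve_right h3
  generalize (∏ q ∈ (Finset.univ : Finset (Fin n × Fin n)).filter
    (fun q => q.1 < q.2 ∧ q ≠ (i, j)), pairFactor t (z (σ q.1)) (z (σ q.2))) = R
  push_cast
  linear_combination (((Equiv.Perm.sign σ : ℤ) : ℂ) * R * pairFactor t (z (σ i)) (z (σ j))) * h1 -
    (((Equiv.Perm.sign σ : ℤ) : ℂ) * R * pairFactor t (z (σ j)) (z (σ i))) * h2

/-- The cyclic permutation which moves the last position to the first one. -/
def cyc (m : ℕ) : Equiv.Perm (Fin (m + 1)) := (finRotate (m + 1))⁻¹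

lemma cyc_zero (m : ℕ) : cyc m 0 = Fin.last m := by
  rw [cyc, Equiv.Perm.inv_eq_iff_eq]; simp

lemma cyc_succ {m : ℕ} (k : Fin m) : cyc m k.succ = k.castSucc := by
  rw [cyc, Equiv.Perm.inv_eq_iff_eq]; simp

lemma sign_cyc (m : ℕ) : Equiv.Perm.sign (cyc m) = (-1) ^ m := by
  rw [cyc, Equiv.Perm.sign_inv, sign_finRotate, Nat.add_sub_cancel]

lemma prod_pairs_succ {m : ℕ} (f : Fin (m + 1) → Fin (m + 1) → ℂ) :
    ∏ k, ∏ l ∈ Finset.Ioi k, f k l =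
      (∏ k : Fin m, f 0 k.succ) * ∏ k : Fin m, ∏ l ∈ Finset.Ioi k, f k.succ l.succ := by
  rw [Fin.prod_univ_succ, Fin.prod_Ioi_zero]
  simp only [Fin.prod_Ioi_succ]

lemma prod_pairs_castSucc {m : ℕ} (f : Fin (m + 1) → Fin (m + 1) → ℂ) :
    ∏ k, ∏ l ∈ Finset.Ioi k, f k l = (∏ k : Fin m, f k.castSucc (Fin.last m)) *
      ∏ k : Fin m, ∏ l ∈ Finset.Ioi k, f k.castSucc l.castSucc := by
  have h : ∀ (n : ℕ) (g : Fin n → Fin n → ℂ), ∏ k, ∏ l ∈ Finset.Ioi k, g k l =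
      ∏ k, ∏ l, if k < l then g k l else 1 := by
    intro n g
    refine Finset.prod_congr rfl fun k _ => ?_
    rw [← Finset.prod_filter]
    refine Finset.prod_congr ?_ fun _ _ => rfl
    ext; simp
  rw [h, h, Fin.prod_univ_castSucc]
  simp only [Fin.prod_univ_castSucc, Fin.castSucc_lt_last, if_true, Fin.castSucc_lt_castSucc_iff,
    lt_irrefl, if_false, mul_one, Finset.prod_mul_distrib]
  rw [Finset.prod_eq_one (s := Finset.univ) (f := fun k : Fin m =>
    if Fin.last m < k.castSucc then f (Fin.last m) k.castSucc else 1)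
      fun k _ => if_neg (not_lt.2 (Fin.le_last _))]
  ring

/-- If the factors of the pairs with the last particle are proportional, then so are the
coefficients of `σ` and of its cyclic shift. -/
lemma coeff_mul_cyc {m : ℕ} (t : ℝ) (z : Fin (m + 1) → ℂ) (σ : Equiv.Perm (Fin (m + 1)))
    (E : Fin (m + 1) → ℂ)
    (hE : ∀ k : Fin m, pairFactor t (z (σ (Fin.last m))) (z (σ k.castSucc)) =
      E (σ k.castSucc) * pairFactor t (z (σ k.castSucc)) (z (σ (Fin.last m)))) :
    coeff t z (σ * cyc m) = (-1) ^ m * (∏ k : Fin m, E (σ k.castSucc)) * coeff t z σ := by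
  unfold coeff
  rw [prod_pairs_succ, prod_pairs_castSucc, Equiv.Perm.sign_mul, sign_cyc]
  simp only [Equiv.Perm.mul_apply, cyc_zero, cyc_succ, hE, Finset.prod_mul_distrib]
  push_cast
  ring

/-! ## The action of the transfer matrix for generic momenta -/

lemma prod_range_pad {n : ℕ} (g : ℂ → ℂ) (z : Fin n → ℂ) (σ : Equiv.Perm (Fin n)) :
    ∏ k ∈ Finset.range n, g (pad (fun k => z (σ k)) k) = ∏ k, g (z k) := by
  rw [Finset.prod_range]
  simp only [pad_val]
  exact Equiv.prod_comp σ fun k => g (z k)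

lemma sum_openSum_false {m N : ℕ} (t : ℝ) (z : Fin (m + 1) → ℂ) (hz : ∀ k, z k ≠ 1)
    (ε : Word N) (hε : (ones ε).card = m + 1) (A : Equiv.Perm (Fin (m + 1)) → ℂ)
    (hA : Exchange t z (m + 1) A) :
    ∑ σ, A σ * openSum t (pad fun k => z (σ k)) ε false false =
      (∏ k, L t (z k)) * ∑ σ, A σ * monomial (pad fun k => z (σ k)) ε -
      ∑ σ, A σ * ((L t (z (σ (Fin.last m))) - 1) * z (σ (Fin.last m)) ^ N) *
        (ladder t false (pad fun k => z (σ k)) ε).1 := by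
  have h := (sum_mul_openSum t z hz false ε).1 (by simp [hε]) A (by simpa [hε] using hA)
  simp only [Bool.false_eq_true, if_false, one_mul] at h
  rw [h, Finset.mul_sum, ← Finset.sum_sub_distrib]
  refine Finset.sum_congr rfl fun σ _ => ?_
  have hl : pad (fun k => z (σ k)) m = z (σ (Fin.last m)) :=
    pad_val (fun k => z (σ k)) (Fin.last m)
  rw [ladder_false_snd, hε, prod_range_pad (L t)]
  simp only [Bool.toNat_false, add_zero, Nat.add_sub_cancel, hl]
  have := M_sub_one_mul t (z (σ (Fin.last m)))
  rw [pow_succ]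
  linear_combination (A σ * z (σ (Fin.last m)) ^ N *
    (ladder t false (pad fun k => z (σ k)) ε).1) * this

/-- Reindexing by `cyc` turns the shifted variables of `ladder_true` into those of the empty seam,
which makes the boundary terms comparable with `sum_openSum_false`. -/
lemma sum_openSum_true {m N : ℕ} {t : ℝ} (ht : t ≠ 0) (z : Fin (m + 1) → ℂ) (hz : ∀ k, z k ≠ 1)
    (ε : Word N) (hε : (ones ε).card = m + 1) (A : Equiv.Perm (Fin (m + 1)) → ℂ)
    (hA : Exchange t z (m + 1) A) :
    ∑ σ, A σ * openSum t (pad fun k => z (σ k)) ε true true =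
      (∏ k, M t (z k)) * ∑ σ, A σ * monomial (pad fun k => z (σ k)) ε +
      ∑ σ, A (σ * cyc m) * (L t (z (σ (Fin.last m))) - 1) *
        (ladder t false (pad fun k => z (σ k)) ε).1 := by
  have h := (sum_mul_openSum t z hz true ε).2 (by simp [hε]) A (by simpa [hε] using hA)
  have ht' : (t : ℂ) ≠ 0 := by exact_mod_cast ht
  simp only [if_true, mul_left_comm _ (t : ℂ), ← Finset.mul_sum] at h
  rw [mul_left_cancel₀ ht' h, Finset.mul_sum]
  have e : ∑ σ : Equiv.Perm (Fin (m + 1)), A (σ * cyc m) * (L t (z (σ (Fin.last m))) - 1) *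
        (ladder t false (pad fun k => z (σ k)) ε).1 =
      ∑ σ : Equiv.Perm (Fin (m + 1)), A σ * (L t (pad (fun k => z (σ k)) 0) - 1) *
        (ladder t false (fun k => pad (fun k => z (σ k)) (k + 1)) ε).1 := by
    refine Eq.trans ?_ (Equiv.sum_comp (Equiv.mulRight (cyc m)) _)
    refine Finset.sum_congr rfl fun σ _ => ?_
    have h0 : pad (fun k => z ((σ * cyc m) k)) 0 = z (σ (Fin.last m)) := by
      rw [pad_of_lt _ m.succ_pos, Fin.mk_zero', Equiv.Perm.mul_apply, cyc_zero]
    simp only [Equiv.coe_mulRight, h0]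
    congr 1
    refine (ladder_congr t false ε).1 fun k hk => ?_
    have hk' : k < m := by simpa [hε] using hk
    rw [pad_of_lt _ (show k < m + 1 by omega), pad_of_lt _ (show k + 1 < m + 1 by omega)]
    have := cyc_succ ⟨k, hk'⟩
    rw [Fin.succ_mk, Fin.castSucc_mk] at this
    rw [Equiv.Perm.mul_apply, this]
  rw [e, ← Finset.sum_add_distrib]
  refine Finset.sum_congr rfl fun σ _ => ?_
  rw [(ladder_true t _ ε).2, hε, prod_range_pad (M t)]
  ring

/-- This trades the ladder, which has poles at `z = 1`, for a polynomial in the variables; the limit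
at a vanishing momentum needs it. -/
lemma sum_openSum_false_true {m N : ℕ} {t : ℝ} (ht : t ≠ 0) (z : Fin (m + 1) → ℂ)
    (hz : ∀ k, z k ≠ 1)
    (ε : Word N) (hε : (ones ε).card = m + 1) (B : Equiv.Perm (Fin (m + 1)) → ℂ)
    (hB : Exchange t z m B) :
    ∑ σ, B σ * (ladder t false (pad fun k => z (σ k)) ε).1 =
      ∑ σ, B σ * (openSum t (pad fun k => z (σ k)) ε false true / t) := by
  have h := (sum_mul_openSum t z hz false ε).2 (by simp [hε]) B (by simpa [hε] using hB)
  have ht' : (t : ℂ) ≠ 0 := by exact_mod_cast ht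
  simp only [Bool.false_eq_true, if_false, one_mul, mul_left_comm _ (t : ℂ), ← Finset.mul_sum] at h
  refine mul_left_cancel₀ ht' (h.symm.trans ?_)
  rw [Finset.mul_sum]
  refine Finset.sum_congr rfl fun σ _ => ?_
  field_simp

lemma Exchange.mul_last {m : ℕ} {t : ℝ} {z : Fin (m + 1) → ℂ}
    {A : Equiv.Perm (Fin (m + 1)) → ℂ} (h : Exchange t z m A) (g : ℂ → ℂ) :
    Exchange t z m (fun σ => A σ * g (z (σ (Fin.last m)))) := by
  have := h.mul_pad g le_rfl
  have hl : ∀ σ : Equiv.Perm (Fin (m + 1)), pad (fun k => z (σ k)) m = z (σ (Fin.last m)) :=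
    fun σ => pad_val (fun k => z (σ k)) (Fin.last m)
  simpa only [hl] using this

/-- Conjugation by the cyclic shift carries the transposition of positions `k + 1, k + 2` to that of
`k, k + 1`. -/
lemma Exchange.cyc {m : ℕ} {t : ℝ} {z : Fin (m + 1) → ℂ}
    {A : Equiv.Perm (Fin (m + 1)) → ℂ} (h : Exchange t z (m + 1) A) :
    Exchange t z m (fun σ => A (σ * cyc m)) := by
  intro k hk hkm σ
  have h1 := h (k + 1) (by omega) (by omega) (σ * SquareIce.cyc m)
  have hk2 : k < m := by omega
  have e1 := cyc_succ ⟨k, hk2⟩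
  have e2 := cyc_succ ⟨k + 1, hkm⟩
  simp only [Fin.succ_mk, Fin.castSucc_mk] at e1 e2
  simp only [Equiv.Perm.mul_apply, e1, e2] at h1
  have e3 : SquareIce.cyc m * Equiv.swap ⟨k + 1, by omega⟩ ⟨k + 1 + 1, by omega⟩ =
      Equiv.swap ⟨k, by omega⟩ ⟨k + 1, hk⟩ * SquareIce.cyc m := by
    rw [Equiv.mul_swap_eq_swap_mul, e1, e2]
  rw [mul_assoc, e3, ← mul_assoc] at h1
  exact h1

/-! ## The Bethe equations -/

lemma pairFactor_exp {t x y : ℝ} (h : (t, x, y) ∈ thetaDomain) :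
    pairFactor t (Complex.exp (Complex.I * x)) (Complex.exp (Complex.I * y)) =
      Complex.exp (-Complex.I * Theta t x y) *
        pairFactor t (Complex.exp (Complex.I * y)) (Complex.exp (Complex.I * x)) := by
  have e := isTheta_Theta.exp_eq t x y h
  have hd : Complex.exp (-Complex.I * y) + Complex.exp (Complex.I * x) - 2 * (Delta t : ℂ) ≠ 0 := by
    -- A zero denominator would make the quotient `0` by convention, but an exponential is never
    -- zero.
    intro h0
    rw [h0, div_zero, mul_zero] at e
    exact Complex.exp_ne_zero _ e
  have h2 : Complex.exp (Complex.I * ((x : ℂ) - (y : ℂ))) * Complex.exp (Complex.I * y) =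
      Complex.exp (Complex.I * x) := by
    rw [← Complex.exp_add]; congr 1; ring
  have h3 := congrArg (· * (Complex.exp (-Complex.I * y) + Complex.exp (Complex.I * x)
    - 2 * (Delta t : ℂ))) e
  simp only [mul_assoc, div_mul_cancel₀ _ hd] at h3
  rw [← exp_mul_eq_pairFactor, ← exp_mul_eq_pairFactor]
  linear_combination (-Complex.exp (Complex.I * y)) * h3 -
    (Complex.exp (-Complex.I * x) + Complex.exp (Complex.I * y) - 2 * (Delta t : ℂ)) * h2

lemma exp_neg_I_mul_Theta_self {t x : ℝ} (h : (t, x, x) ∈ thetaDomain) :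
    Complex.exp (-Complex.I * Theta t x x) = 1 := by
  have e := isTheta_Theta.exp_eq t x x h
  have hd : Complex.exp (-Complex.I * x) + Complex.exp (Complex.I * x) - 2 * (Delta t : ℂ) ≠ 0 := by
    intro h0
    rw [h0, div_zero, mul_zero] at e
    exact Complex.exp_ne_zero _ e
  rw [e, div_self hd]
  simp

/-- The cyclic shift of a permutation multiplies its coefficient by a product of phases. -/
lemma coeff_mul_cyc_eq {m : ℕ} {t : ℝ} (ht : t ∈ Set.Ioo (0 : ℝ) 2) (q : Fin (m + 1) → ℝ)
    (hq : ∀ k, q k ∈ Interval t) (σ : Equiv.Perm (Fin (m + 1))) :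
    coeff t (fun k => Complex.exp (Complex.I * q k)) (σ * cyc m) =
      (-1) ^ m * (∏ k, Complex.exp (-Complex.I * Theta t (q (σ (Fin.last m))) (q k))) *
        coeff t (fun k => Complex.exp (Complex.I * q k)) σ := by
  rw [coeff_mul_cyc t _ σ
    (fun k => Complex.exp (-Complex.I * Theta t (q (σ (Fin.last m))) (q k)))
    fun k => pairFactor_exp ⟨ht, hq _, hq _⟩]
  congr 2
  rw [← Equiv.prod_comp σ (fun k => Complex.exp (-Complex.I * Theta t (q (σ (Fin.last m))) (q k))),
    Fin.prod_univ_castSucc, exp_neg_I_mul_Theta_self ⟨ht, hq _, hq _⟩, mul_one]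

lemma BetheEquations.exp_pow {m N : ℕ} {t : ℝ} {p : Fin (m + 1) → ℝ}
    (h : BetheEquations t N p) (j : Fin (m + 1)) :
    Complex.exp (Complex.I * p j) ^ N =
      (-1) ^ m * ∏ k, Complex.exp (-Complex.I * Theta t (p j) (p k)) := by
  have h1 : (N : ℂ) * p j = 2 * Real.pi * ((j : ℕ) + 1) - ((m : ℂ) + 1 + 1) * Real.pi
      - ∑ k, (Theta t (p j) (p k) : ℂ) := by exact_mod_cast h j
  have h2 : (N : ℂ) * (Complex.I * p j) = (((j : ℕ) : ℤ) : ℂ) * (2 * Real.pi * Complex.I)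
      + (-(m * (Real.pi * Complex.I)) + ∑ k, (-Complex.I * Theta t (p j) (p k) : ℂ)) := by
    rw [← Finset.mul_sum]
    push_cast
    linear_combination Complex.I * h1
  rw [← Complex.exp_nat_mul, h2, Complex.exp_add, Complex.exp_int_mul_two_pi_mul_I, one_mul,
    Complex.exp_add, Complex.exp_sum, Complex.exp_neg, Complex.exp_nat_mul, Complex.exp_pi_mul_I,
    ← inv_pow]
  norm_num

lemma coeff_mul_cyc_of_bethe {m N : ℕ} {t : ℝ} (ht : t ∈ Set.Ioo (0 : ℝ) 2)
    {p : Fin (m + 1) → ℝ} (hp : ∀ k, p k ∈ Interval t) (h : BetheEquations t N p)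
    (σ : Equiv.Perm (Fin (m + 1))) :
    coeff t (fun k => Complex.exp (Complex.I * p k)) (σ * cyc m) =
      Complex.exp (Complex.I * p (σ (Fin.last m))) ^ N *
        coeff t (fun k => Complex.exp (Complex.I * p k)) σ := by
  rw [coeff_mul_cyc_eq ht p hp, h.exp_pow]

lemma exp_I_mul_ne_one {t x : ℝ} (hx : x ∈ Interval t) (h0 : x ≠ 0) :
    Complex.exp (Complex.I * x) ≠ 1 := by
  intro h
  rw [Interval_eq, Set.mem_Ioo] at hx
  have hpi := Real.arccos_le_pi (Delta t)
  have h1 : Real.cos x = 1 := by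
    rw [mul_comm, Complex.exp_mul_I] at h
    have := congrArg Complex.re h
    simpa [Complex.cos_ofReal_re, Complex.sin_ofReal_im] using this
  exact h0 ((Real.cos_eq_one_iff_of_lt_of_lt (by linarith) (by linarith)).1 h1)

lemma mulVec_betheVector_of_ne_zero {m N : ℕ} {t : ℝ} (ht : t ∈ Set.Ioo (0 : ℝ) 2)
    {p : Fin (m + 1) → ℝ} (hp : ∀ k, p k ∈ Interval t) (hB : BetheEquations t (N + 1) p)
    (h0 : ∀ j, p j ≠ 0) (ε : Word (N + 1)) (hε : (ones ε).card = m + 1) :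
    (transferMatrix (N + 1) t).mulVec (betheVector t (N + 1) p) ε =
      betheEigenvalue t (N + 1) p * betheVector t (N + 1) p ε := by
  have hz : ∀ k, Complex.exp (Complex.I * p k) ≠ 1 := fun k => exp_I_mul_ne_one (hp k) (h0 k)
  rw [transferMatrix_mulVec_betheVector t p ε hε, betheVector_eq, if_pos hε, betheEigenvalue,
    if_pos h0]
  simp only [coeffC_eq, mul_add, Finset.sum_add_distrib]
  have hE := exchange_coeff t (fun k => Complex.exp (Complex.I * p k)) hz (m + 1)
  have e1 := sum_openSum_false t (fun k => Complex.exp (Complex.I * p k)) hz ε hε _ hE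
  have e2 := sum_openSum_true ht.1.ne' (fun k => Complex.exp (Complex.I * p k)) hz ε hε _ hE
  simp only [coeff_mul_cyc_of_bethe ht hp hB] at e2
  rw [e1, e2]
  -- The boundary terms of the two seam states are `c` and `d`; the Bethe equations have made them
  -- equal.
  have e3 : ∀ a b c d : ℂ, c = d → a - c + (b + d) = a + b := by
    rintro a b c d rfl; ring
  refine (e3 _ _ _ _ (Finset.sum_congr rfl fun σ _ => ?_)).trans (add_mul _ _ _).symm
  ring

section

open Filter Topology

/-! ## A vanishing momentum -/

lemma L_sub_one_mul_one_sub (t : ℝ) {z : ℂ} (hz : z ≠ 1) :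
    (L t z - 1) * (1 - z) = (t : ℂ) ^ 2 * z := by
  have : 1 - z ≠ 0 := sub_ne_zero.2 hz.symm
  unfold L; field_simp; ring

lemma L_add_M (t : ℝ) {z : ℂ} (hz : z ≠ 1) : L t z + M t z = 2 - (t : ℂ) ^ 2 := by
  have : 1 - z ≠ 0 := sub_ne_zero.2 hz.symm
  unfold L M; field_simp; ring

/-- For each other momentum `-M` equals `L` times the phase `exp (-i Θ (0, p k))`, and the Bethe
equation at `l` says that these phases multiply to `(-1) ^ m`. -/
lemma prod_L_eq_prod_M {m N : ℕ} {t : ℝ} (ht : t ∈ Set.Ioo (0 : ℝ) 2)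
    {p : Fin (m + 1) → ℝ} (hp : ∀ k, p k ∈ Interval t) (hB : BetheEquations t N p)
    {l : Fin (m + 1)} (hl : p l = 0) (hne : ∀ k, k ≠ l → p k ≠ 0) :
    ∏ k ∈ Finset.univ.erase l, L t (Complex.exp (Complex.I * p k)) =
      ∏ k ∈ Finset.univ.erase l, M t (Complex.exp (Complex.I * p k)) := by
  have h1 := hB.exp_pow l
  rw [← Finset.mul_prod_erase _ _ (Finset.mem_univ l), hl,
    exp_neg_I_mul_Theta_self ⟨ht, hl ▸ hp l, hl ▸ hp l⟩, Complex.ofReal_zero, mul_zero,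
    Complex.exp_zero, one_pow, one_mul] at h1
  have h2 : ∏ k ∈ Finset.univ.erase l, -M t (Complex.exp (Complex.I * p k)) =
      ∏ k ∈ Finset.univ.erase l, (Complex.exp (-Complex.I * Theta t 0 (p k)) *
        L t (Complex.exp (Complex.I * p k))) := by
    refine Finset.prod_congr rfl fun k hk => ?_
    have hz := exp_I_mul_ne_one (hp k) (hne k (Finset.ne_of_mem_erase hk))
    have h3 := pairFactor_exp (t := t) (x := 0) (y := p k) ⟨ht, hl ▸ hp l, hp k⟩
    have h4 : 1 - Complex.exp (Complex.I * p k) ≠ 0 := sub_ne_zero.2 hz.symm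
    refine mul_right_cancel₀ h4 ?_
    rw [Complex.ofReal_zero, mul_zero, Complex.exp_zero] at h3
    generalize Complex.exp (-Complex.I * Theta t 0 (p k)) = E at h3 ⊢
    unfold pairFactor Delta at h3
    push_cast at h3
    unfold L M
    field_simp
    linear_combination h3
  rw [Finset.prod_neg, Finset.card_erase_of_mem (Finset.mem_univ l), Finset.card_univ,
    Fintype.card_fin, Nat.add_sub_cancel, Finset.prod_mul_distrib] at h2
  have h5 : ((-1 : ℂ) ^ m) * (-1) ^ m = 1 := by rw [← mul_pow]; norm_num
  linear_combination (-(-1) ^ m) * h2 + (∏ k ∈ Finset.univ.erase l,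
    L t (Complex.exp (Complex.I * p k))) * h1 +
    (∏ k ∈ Finset.univ.erase l, M t (Complex.exp (Complex.I * p k))) * h5

/-! ### Derivatives and continuity near the vanishing momentum -/

lemma tendsto_div_of_hasDerivAt {f g : ℝ → ℂ} {a : ℝ} {f' g' : ℂ} (hf : HasDerivAt f f' a)
    (hg : HasDerivAt g g' a) (hfa : f a = 0) (hga : g a = 0) (hg' : g' ≠ 0) :
    Tendsto (fun x => f x / g x) (𝓝[≠] a) (𝓝 (f' / g')) := by
  refine ((hasDerivAt_iff_tendsto_slope.1 hf).div (hasDerivAt_iff_tendsto_slope.1 hg) hg').congr' ?_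
  filter_upwards [self_mem_nhdsWithin] with x hx
  have : ((x - a : ℝ) : ℂ) ≠ 0 := by exact_mod_cast sub_ne_zero.2 hx
  simp only [Pi.div_apply, slope_def_module, hfa, hga, sub_zero, Complex.real_smul]
  rw [mul_div_mul_left]
  simpa using this

lemma differentiableAt_Theta {t x y : ℝ} (h : (t, x, y) ∈ thetaDomain) :
    DifferentiableAt ℝ (fun x => Theta t x y) x := by
  have h1 := (isTheta_Theta.analytic _ h).differentiableAt
  have h2 : DifferentiableAt ℝ (fun x : ℝ => ((t, x, y) : ℝ × ℝ × ℝ)) x := by fun_prop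
  exact DifferentiableAt.comp (f := fun x : ℝ => ((t, x, y) : ℝ × ℝ × ℝ)) x h1 h2

lemma continuous_coeff {n : ℕ} (t : ℝ) {z : ℝ → Fin n → ℂ} (hz : ∀ k, Continuous fun x => z x k)
    (σ : Equiv.Perm (Fin n)) : Continuous fun x => coeff t (z x) σ := by
  unfold coeff pairFactor
  fun_prop

lemma continuous_pad {n : ℕ} {z : ℝ → Fin n → ℂ} (hz : ∀ k, Continuous fun x => z x k)
    (σ : Equiv.Perm (Fin n)) (k : ℕ) : Continuous fun x => pad (fun j => z x (σ j)) k := by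
  unfold pad
  split_ifs
  · exact hz _
  · exact continuous_const

lemma continuous_monomial {a : ℝ → ℕ → ℂ} (ha : ∀ k, Continuous fun x => a x k) {N : ℕ}
    (η : Word N) : Continuous fun x => monomial (a x) η := by
  unfold monomial
  refine continuous_finsetProd _ fun i _ => ?_
  split_ifs
  · exact (ha _).pow _
  · exact continuous_const

lemma continuous_openSum (t : ℝ) {a : ℝ → ℕ → ℂ} (ha : ∀ k, Continuous fun x => a x k) {N : ℕ}
    (ε : Word N) (h₀ h : Bool) : Continuous fun x => openSum t (a x) ε h₀ h := by
  unfold openSum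
  refine continuous_finsetSum _ fun w _ => ?_
  split_ifs
  · exact continuous_const.mul (continuous_monomial ha _)
  · exact continuous_const

/-- The derivative at a vanishing momentum of the defect of its Bethe equation. -/
lemma tendsto_bethe_defect {m N : ℕ} {t : ℝ} (ht : t ∈ Set.Ioo (0 : ℝ) 2)
    {p : Fin (m + 1) → ℝ} (hp : ∀ k, p k ∈ Interval t) (hB : BetheEquations t N p)
    {l : Fin (m + 1)} (hl : p l = 0) :
    Tendsto (fun x : ℝ => ((-1) ^ m * (∏ k ∈ Finset.univ.erase l,
        Complex.exp (-Complex.I * Theta t x (p k))) - Complex.exp (Complex.I * x) ^ N) /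
          (1 - Complex.exp (Complex.I * x))) (𝓝[≠] 0)
      (𝓝 (N + ∑ k ∈ Finset.univ.erase l, deriv (fun x => Theta t x (p k)) 0 : ℝ)) := by
  have h1 := hB.exp_pow l
  rw [← Finset.mul_prod_erase _ _ (Finset.mem_univ l), hl,
    exp_neg_I_mul_Theta_self ⟨ht, hl ▸ hp l, hl ▸ hp l⟩, Complex.ofReal_zero, mul_zero,
    Complex.exp_zero, one_pow, one_mul, ← Complex.exp_sum] at h1
  have hI : HasDerivAt (fun x : ℝ => Complex.exp (Complex.I * x)) Complex.I 0 := by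
    have := ((HasDerivAt.ofReal_comp (hasDerivAt_id (0 : ℝ))).const_mul Complex.I).cexp
    simpa using this
  have hN := hI.pow N
  have hS : HasDerivAt (fun x : ℝ => (-1 : ℂ) ^ m * Complex.exp (∑ k ∈ Finset.univ.erase l,
      (-Complex.I * Theta t x (p k) : ℂ))) ((-1) ^ m * (Complex.exp (∑ k ∈ Finset.univ.erase l,
        (-Complex.I * Theta t 0 (p k) : ℂ)) * ∑ k ∈ Finset.univ.erase l,
          (-Complex.I * (deriv (fun x => Theta t x (p k)) 0 : ℝ) : ℂ))) 0 := by
    refine (HasDerivAt.cexp (HasDerivAt.fun_sum fun k _ => ?_)).const_mul _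
    exact ((differentiableAt_Theta ⟨ht, hl ▸ hp l, hp k⟩).hasDerivAt.ofReal_comp).const_mul _
  rw [← mul_assoc, ← h1, one_mul] at hS
  -- Both parts of the quotient vanish at `0`, the numerator by the Bethe equation at `l`; their
  -- derivatives are `-i` times the limit, and `-i`.
  have := tendsto_div_of_hasDerivAt (hS.sub hN) (hI.const_sub 1)
    (by simp only [Pi.sub_apply, Pi.pow_apply]; rw [← h1]; simp) (by simp)
    (by simp)
  convert this using 2
  · simp only [Complex.exp_sum, Pi.sub_apply, Pi.pow_apply]
  · rw [← Finset.mul_sum]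
    have : Complex.I ≠ 0 := Complex.I_ne_zero
    push_cast
    field_simp
    simp
    ring

lemma eq_zero_of_eventually_punctured {f : ℝ → ℂ} (hf : Continuous f) {a : ℝ}
    (h : ∀ᶠ x in 𝓝[≠] a, f x = 0) : f a = 0 := by
  have h1 : Tendsto f (𝓝[≠] a) (𝓝 (f a)) := hf.continuousAt.tendsto.mono_left nhdsWithin_le_nhds
  exact tendsto_nhds_unique h1 (tendsto_const_nhds.congr' (h.mono fun x hx => hx.symm))

/-- The momenta `p` with the vanishing one, `p_l`, moved to `x`. -/
noncomputable def movedExp {n : ℕ} (p : Fin n → ℝ) (l : Fin n) (x : ℝ) (k : Fin n) : ℂ :=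
  Complex.exp (Complex.I * Function.update p l x k)

lemma movedExp_self {n : ℕ} (p : Fin n → ℝ) (l : Fin n) (x : ℝ) :
    movedExp p l x l = Complex.exp (Complex.I * x) := by simp [movedExp]

lemma movedExp_of_ne {n : ℕ} (p : Fin n → ℝ) {l k : Fin n} (h : k ≠ l) (x : ℝ) :
    movedExp p l x k = Complex.exp (Complex.I * p k) := by simp [movedExp, h]

lemma movedExp_zero {n : ℕ} (p : Fin n → ℝ) {l : Fin n} (hl : p l = 0) :
    movedExp p l 0 = fun k => Complex.exp (Complex.I * p k) := by
  funext k
  rw [movedExp, Function.update_eq_self_iff.2 hl.symm]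

lemma continuous_movedExp {n : ℕ} (p : Fin n → ℝ) (l k : Fin n) :
    Continuous fun x => movedExp p l x k := by
  unfold movedExp
  by_cases h : k = l
  · subst h; simp only [Function.update_self]; fun_prop
  · simp only [Function.update_of_ne h]; fun_prop

lemma eventually_update_mem {n : ℕ} {t : ℝ} {p : Fin n → ℝ} (hp : ∀ k, p k ∈ Interval t)
    {l : Fin n} (hl : p l = 0) :
    ∀ᶠ x in 𝓝[≠] (0 : ℝ), x ≠ 0 ∧ ∀ k, Function.update p l x k ∈ Interval t := by
  have h1 : Interval t ∈ 𝓝 (0 : ℝ) := isOpen_Ioo.mem_nhds (hl ▸ hp l)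
  filter_upwards [self_mem_nhdsWithin, nhdsWithin_le_nhds h1] with x hx hxI
  refine ⟨hx, fun k => ?_⟩
  by_cases h : k = l
  · subst h; simpa using hxI
  · simpa [h] using hp k

lemma update_ne_zero {n : ℕ} {p : Fin n → ℝ} {l : Fin n} (hne : ∀ k, k ≠ l → p k ≠ 0) {x : ℝ}
    (hx : x ≠ 0) (k : Fin n) : Function.update p l x k ≠ 0 := by
  by_cases h : k = l
  · subst h; simpa using hx
  · simpa [h] using hne k h

lemma sum_openSum_false_eq {m N : ℕ} {t : ℝ} (ht : t ≠ 0) (z : Fin (m + 1) → ℂ)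
    (hz : ∀ k, z k ≠ 1) (ε : Word N) (hε : (ones ε).card = m + 1) :
    ∑ σ, coeff t z σ * openSum t (pad fun k => z (σ k)) ε false false =
      (∏ k, L t (z k)) * ∑ σ, coeff t z σ * monomial (pad fun k => z (σ k)) ε -
      ∑ σ, coeff t z σ * ((L t (z (σ (Fin.last m))) - 1) * z (σ (Fin.last m)) ^ N) *
        (openSum t (pad fun k => z (σ k)) ε false true / t) := by
  rw [sum_openSum_false t z hz ε hε _ (exchange_coeff t z hz _), sum_openSum_false_true ht z hz ε hε
    (fun σ => coeff t z σ * ((L t (z (σ (Fin.last m))) - 1) * z (σ (Fin.last m)) ^ N))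
    ((exchange_coeff t z hz m).mul_last fun w => (L t w - 1) * w ^ N)]

lemma sum_openSum_true_eq {m N : ℕ} {t : ℝ} (ht : t ≠ 0) (z : Fin (m + 1) → ℂ)
    (hz : ∀ k, z k ≠ 1) (ε : Word N) (hε : (ones ε).card = m + 1) :
    ∑ σ, coeff t z σ * openSum t (pad fun k => z (σ k)) ε true true =
      (∏ k, M t (z k)) * ∑ σ, coeff t z σ * monomial (pad fun k => z (σ k)) ε +
      ∑ σ, coeff t z (σ * cyc m) * (L t (z (σ (Fin.last m))) - 1) *
        (openSum t (pad fun k => z (σ k)) ε false true / t) := by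
  rw [sum_openSum_true ht z hz ε hε _ (exchange_coeff t z hz _), sum_openSum_false_true ht z hz ε hε
    (fun σ => coeff t z (σ * cyc m) * (L t (z (σ (Fin.last m))) - 1))
    ((exchange_coeff t z hz (m + 1)).cyc.mul_last fun w => L t w - 1)]

/-- The partition function of the empty seam is polynomial, so in `sum_openSum_false_eq` the poles
at `x = 0` on the right must cancel. This compares their residues. -/
lemma sum_residue {m N : ℕ} {t : ℝ} (ht : t ∈ Set.Ioo (0 : ℝ) 2) {p : Fin (m + 1) → ℝ}
    (hp : ∀ k, p k ∈ Interval t) {l : Fin (m + 1)} (hl : p l = 0) (hne : ∀ k, k ≠ l → p k ≠ 0)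
    (ε : Word N) (hε : (ones ε).card = m + 1) :
    ∑ σ : Equiv.Perm (Fin (m + 1)), (if σ (Fin.last m) = l then
        coeff t (movedExp p l 0) σ *
          (openSum t (pad fun k => movedExp p l 0 (σ k)) ε false true / t) else 0) =
      (∏ k ∈ Finset.univ.erase l, L t (Complex.exp (Complex.I * p k))) *
        ∑ σ, coeff t (movedExp p l 0) σ * monomial (pad fun k => movedExp p l 0 (σ k)) ε := by
  have ht0 : (t : ℂ) ≠ 0 := by exact_mod_cast ht.1.ne'
  set z := movedExp p l with hzdef
  have hzc : ∀ k, Continuous fun x => z x k := continuous_movedExp p l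
  set PL := ∏ k ∈ Finset.univ.erase l, L t (Complex.exp (Complex.I * p k)) with hPL
  -- The identity is multiplied by `1 - z x l`, with the pole of `L` cleared by hand, so that `f` is
  -- continuous at `0`.
  let f : ℝ → ℂ := fun x => (1 - z x l) *
      ∑ σ, coeff t (z x) σ * openSum t (pad fun k => z x (σ k)) ε false false +
    ∑ σ : Equiv.Perm (Fin (m + 1)), coeff t (z x) σ * ((if σ (Fin.last m) = l then
        (t : ℂ) ^ 2 * z x l else (1 - z x l) *
          (L t (Complex.exp (Complex.I * p (σ (Fin.last m)))) - 1)) * z x (σ (Fin.last m)) ^ N) *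
      (openSum t (pad fun k => z x (σ k)) ε false true / t) -
    ((1 - z x l) + (t : ℂ) ^ 2 * z x l) * PL *
      ∑ σ, coeff t (z x) σ * monomial (pad fun k => z x (σ k)) ε
  have hf : Continuous f := by
    have c1 := fun σ => continuous_coeff t hzc σ
    have c2 := fun σ h => continuous_openSum t (continuous_pad hzc σ) ε false h
    have c3 := fun σ => continuous_monomial (continuous_pad hzc σ) ε
    refine ((continuous_const.sub (hzc l)).mul (continuous_finsetSum _ fun σ _ =>
      (c1 σ).mul (c2 σ false))).add (continuous_finsetSum _ fun σ _ => ?_) |>.sub ?_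
    · refine ((c1 σ).mul (Continuous.mul ?_ ((hzc _).pow N))).mul ((c2 σ true).div_const _)
      split_ifs
      · exact continuous_const.mul (hzc l)
      · exact (continuous_const.sub (hzc l)).mul continuous_const
    · exact (((continuous_const.sub (hzc l)).add (continuous_const.mul (hzc l))).mul
        continuous_const).mul (continuous_finsetSum _ fun σ _ => (c1 σ).mul (c3 σ))
  have h0 : f 0 = 0 := by
    refine eq_zero_of_eventually_punctured hf ((eventually_update_mem hp hl).mono ?_)
    rintro x ⟨hx, hxI⟩
    have hz1 : ∀ k, z x k ≠ 1 := fun k => exp_I_mul_ne_one (hxI k) (update_ne_zero hne hx k)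
    have e := sum_openSum_false_eq ht.1.ne' (z x) hz1 ε hε
    have e1 := L_sub_one_mul_one_sub t (hz1 l)
    have e2 : ∏ k, L t (z x k) = L t (z x l) * PL := by
      rw [← Finset.mul_prod_erase _ _ (Finset.mem_univ l)]
      congr 1
      refine Finset.prod_congr rfl fun k hk => ?_
      rw [hzdef, movedExp_of_ne p (Finset.ne_of_mem_erase hk)]
    have e3 : (∑ σ : Equiv.Perm (Fin (m + 1)), coeff t (z x) σ * ((if σ (Fin.last m) = l then
        (t : ℂ) ^ 2 * z x l else (1 - z x l) *
          (L t (Complex.exp (Complex.I * p (σ (Fin.last m)))) - 1)) * z x (σ (Fin.last m)) ^ N) *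
      (openSum t (pad fun k => z x (σ k)) ε false true / t)) = (1 - z x l) *
        ∑ σ, coeff t (z x) σ * ((L t (z x (σ (Fin.last m))) - 1) * z x (σ (Fin.last m)) ^ N) *
        (openSum t (pad fun k => z x (σ k)) ε false true / t) := by
      rw [Finset.mul_sum]
      refine Finset.sum_congr rfl fun σ _ => ?_
      split_ifs with h
      · rw [h, ← e1]; ring
      · rw [hzdef, movedExp_of_ne p h]; ring
    simp only [f]
    rw [e3, e, e2, ← e1]
    ring
  have hz0 : z 0 l = 1 := by rw [hzdef, movedExp_self]; simp
  simp only [f, hz0, sub_self, zero_mul, zero_add, mul_one] at h0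
  rw [sub_eq_zero, mul_assoc] at h0
  refine mul_left_cancel₀ (pow_ne_zero 2 ht0) (Eq.trans ?_ h0)
  rw [Finset.mul_sum]
  refine Finset.sum_congr rfl fun σ _ => ?_
  split_ifs with h
  · rw [h, hz0]; ring
  · simp

lemma mulVec_betheVector_of_eq_zero {m N : ℕ} {t : ℝ} (ht : t ∈ Set.Ioo (0 : ℝ) 2)
    {p : Fin (m + 1) → ℝ} (hp : ∀ k, p k ∈ Interval t) (hB : BetheEquations t (N + 1) p)
    {l : Fin (m + 1)} (hl : p l = 0) (hne : ∀ k, k ≠ l → p k ≠ 0)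
    (ε : Word (N + 1)) (hε : (ones ε).card = m + 1) :
    (transferMatrix (N + 1) t).mulVec (betheVector t (N + 1) p) ε =
      betheEigenvalue t (N + 1) p * betheVector t (N + 1) p ε := by
  have hfilter : (Finset.univ.filter fun k => p k ≠ 0) = Finset.univ.erase l := by
    ext k
    simp only [Finset.mem_filter, Finset.mem_univ, true_and, Finset.mem_erase, and_true]
    exact ⟨fun h h' => h (h' ▸ hl), hne k⟩
  set PM := ∏ k ∈ Finset.univ.erase l, M t (Complex.exp (Complex.I * p k)) with hPM
  set D := ∑ k ∈ Finset.univ.erase l, deriv (fun x => Theta t x (p k)) 0 with hD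
  have hΛ : betheEigenvalue t (N + 1) p = (2 + (t : ℂ) ^ 2 * N + (t : ℂ) ^ 2 * D) * PM := by
    rw [betheEigenvalue, if_neg fun h => h l hl]
    simp only [hfilter, ← hD, ← hPM]
    push_cast
    ring
  have hres := sum_residue ht hp hl hne ε hε
  rw [prod_L_eq_prod_M ht hp hB hl hne] at hres
  rw [transferMatrix_mulVec_betheVector t p ε hε, betheVector_eq, if_pos hε, hΛ]
  simp only [coeffC_eq]
  set z := movedExp p l with hzdef
  have hz0 : z 0 = fun k => Complex.exp (Complex.I * p k) := movedExp_zero p hl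
  have hzc : ∀ k, Continuous fun x => z x k := continuous_movedExp p l
  rw [← hz0]
  have hz0' : ∀ σ : Equiv.Perm (Fin (m + 1)),
      (fun k => Complex.exp (Complex.I * p (σ k))) = fun k => z 0 (σ k) := by
    intro σ; rw [hz0]
  simp only [hz0']
  have c1 := fun σ => continuous_coeff t hzc σ
  have c2 := fun σ h₀ h => continuous_openSum t (continuous_pad hzc σ) ε h₀ h
  have c3 := fun σ => continuous_monomial (continuous_pad hzc σ) ε
  let R : ℝ → ℂ := fun x => ((-1) ^ m * (∏ k ∈ Finset.univ.erase l,
    Complex.exp (-Complex.I * Theta t x (p k))) - Complex.exp (Complex.I * x) ^ (N + 1)) /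
      (1 - Complex.exp (Complex.I * x))
  have hR : Tendsto R (𝓝[≠] 0) (𝓝 (((N + 1 : ℕ) + D : ℝ) : ℂ)) := tendsto_bethe_defect ht hp hB hl
  -- `S` is the difference of the boundary terms. If `l` is last, the pole of `L` meets a defect
  -- vanishing at first order; otherwise `L` is constant and the defect tends to `0`.
  let S : Equiv.Perm (Fin (m + 1)) → ℝ → ℂ := fun σ x => (if σ (Fin.last m) = l then
    (t : ℂ) ^ 2 * z x l * R x * coeff t (z x) σ else
      (L t (Complex.exp (Complex.I * p (σ (Fin.last m)))) - 1) * (coeff t (z x) (σ * cyc m) -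
        z x (σ (Fin.last m)) ^ (N + 1) * coeff t (z x) σ)) *
    (openSum t (pad fun k => z x (σ k)) ε false true / t)
  have hlim : ∀ {f : ℝ → ℂ}, Continuous f → Tendsto f (𝓝[≠] 0) (𝓝 (f 0)) := fun hf =>
    hf.continuousAt.tendsto.mono_left nhdsWithin_le_nhds
  have hz01 : z 0 l = 1 := by rw [hzdef, movedExp_self]; simp
  have hS : ∀ σ, Tendsto (S σ) (𝓝[≠] 0) (𝓝 ((t : ℂ) ^ 2 * (((N + 1 : ℕ) + D : ℝ) : ℂ) *
      (if σ (Fin.last m) = l then coeff t (z 0) σ *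
        (openSum t (pad fun k => z 0 (σ k)) ε false true / t) else 0))) := by
    intro σ
    have hY := hlim ((c2 σ false true).div_const (t : ℂ))
    by_cases h : σ (Fin.last m) = l
    · simp only [S, h, if_true]
      have := (((hlim (continuous_const.mul (hzc l) (M := ℂ) (f := fun _ => (t : ℂ) ^ 2))).mul
        hR).mul (hlim (c1 σ))).mul hY
      simp only [Pi.mul_apply] at this
      convert this using 2
      rw [hz01]; ring
    · simp only [S, h, if_false, mul_zero]
      have := (hlim (((c1 (σ * cyc m)).sub (((hzc (σ (Fin.last m))).pow (N + 1)).mul (c1 σ))))).const_mul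
        (L t (Complex.exp (Complex.I * p (σ (Fin.last m)))) - 1) |>.mul hY
      simp only [Pi.mul_apply, Pi.sub_apply, Pi.pow_apply] at this
      convert this using 2
      rw [hz0, coeff_mul_cyc_of_bethe ht hp hB]
      ring
  have hsum := tendsto_finsetSum Finset.univ fun σ _ => hS σ
  have hleft : Tendsto (fun x => ∑ σ, S σ x) (𝓝[≠] 0) (𝓝 (∑ σ, coeff t (z 0) σ *
      (openSum t (pad fun k => z 0 (σ k)) ε false false +
        openSum t (pad fun k => z 0 (σ k)) ε true true) -
      (2 - (t : ℂ) ^ 2) * PM *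
        ∑ σ, coeff t (z 0) σ * monomial (pad fun k => z 0 (σ k)) ε)) := by
    have hc : Continuous fun x => ∑ σ, coeff t (z x) σ *
      (openSum t (pad fun k => z x (σ k)) ε false false +
        openSum t (pad fun k => z x (σ k)) ε true true) -
      (2 - (t : ℂ) ^ 2) * PM *
        ∑ σ, coeff t (z x) σ * monomial (pad fun k => z x (σ k)) ε :=
      (continuous_finsetSum _ fun σ _ => (c1 σ).mul ((c2 σ _ _).add (c2 σ _ _))).sub
        (continuous_const.mul (continuous_finsetSum _ fun σ _ => (c1 σ).mul (c3 σ)))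
    refine (hlim hc).congr' ((eventually_update_mem hp hl).mono ?_)
    rintro x ⟨hx, hxI⟩
    have hz1 : ∀ k, z x k ≠ 1 := fun k => exp_I_mul_ne_one (hxI k) (update_ne_zero hne hx k)
    have e1 := sum_openSum_false_eq ht.1.ne' (z x) hz1 ε hε
    have e2 := sum_openSum_true_eq ht.1.ne' (z x) hz1 ε hε
    have e3 : ∏ k, L t (z x k) = L t (z x l) * PM := by
      rw [← Finset.mul_prod_erase _ _ (Finset.mem_univ l), hPM, ← prod_L_eq_prod_M ht hp hB hl hne]
      congr 1
      refine Finset.prod_congr rfl fun k hk => ?_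
      rw [hzdef, movedExp_of_ne p (Finset.ne_of_mem_erase hk)]
    have e4 : ∏ k, M t (z x k) = M t (z x l) * PM := by
      rw [← Finset.mul_prod_erase _ _ (Finset.mem_univ l)]
      congr 1
      refine Finset.prod_congr rfl fun k hk => ?_
      rw [hzdef, movedExp_of_ne p (Finset.ne_of_mem_erase hk)]
    have e5 : ∑ σ, S σ x = ∑ σ, coeff t (z x) (σ * cyc m) * (L t (z x (σ (Fin.last m))) - 1) *
        (openSum t (pad fun k => z x (σ k)) ε false true / t) -
      ∑ σ, coeff t (z x) σ * ((L t (z x (σ (Fin.last m))) - 1) *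
        z x (σ (Fin.last m)) ^ (N + 1)) *
        (openSum t (pad fun k => z x (σ k)) ε false true / t) := by
      rw [← Finset.sum_sub_distrib]
      refine Finset.sum_congr rfl fun σ _ => ?_
      by_cases h : σ (Fin.last m) = l
      · have e6 : coeff t (z x) (σ * cyc m) - z x l ^ (N + 1) * coeff t (z x) σ =
            (1 - z x l) * R x * coeff t (z x) σ := by
          have hu : ∀ k ∈ Finset.univ.erase l, Function.update p l x k = p k := fun k hk =>
            Function.update_of_ne (Finset.ne_of_mem_erase hk) _ _
          have e7 := coeff_mul_cyc_eq ht _ hxI σ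
          rw [h, Function.update_self, ← Finset.mul_prod_erase _ _ (Finset.mem_univ l),
            Function.update_self, exp_neg_I_mul_Theta_self ⟨ht, by simpa using hxI l,
              by simpa using hxI l⟩, one_mul, Finset.prod_congr rfl fun k hk => by rw [hu k hk]] at e7
          have e8 : (1 - z x l) * R x = (-1) ^ m * (∏ k ∈ Finset.univ.erase l,
              Complex.exp (-Complex.I * Theta t x (p k))) - z x l ^ (N + 1) := by
            have h1 := sub_ne_zero.2 (hz1 l).symm
            rw [hzdef, movedExp_self] at h1 ⊢
            exact mul_div_cancel₀ _ h1
          rw [e8, sub_mul]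
          exact congrArg (· - _) e7
        simp only [S, h, if_true]
        rw [← L_sub_one_mul_one_sub t (hz1 l)]
        linear_combination (-(L t (z x l) - 1) *
          (openSum t (pad fun k => z x (σ k)) ε false true / t)) * e6
      · simp only [S, h, if_false]
        rw [hzdef, movedExp_of_ne p h]
        ring
    simp only [mul_add, Finset.sum_add_distrib]
    -- The two singular products add up to `L + M = 2 - t ^ 2` times a constant, which is free of
    -- poles.
    rw [e5, e1, e2, e3, e4, ← L_add_M t (hz1 l)]
    ring
  have key := tendsto_nhds_unique hleft hsum
  rw [← Finset.mul_sum, hres] at key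
  push_cast at key
  -- The constants combine as `2 - t ^ 2 + t ^ 2 * (N + 1 + D)`, the row having `N + 1` cells.
  linear_combination key

/-- Without curves there is no last position to shift; each seam state contributes an empty product,
so the eigenvalue is `2`. -/
lemma mulVec_betheVector_of_empty {N : ℕ} {t : ℝ} (ht : t ≠ 0) (p : Fin 0 → ℝ)
    (ε : Word (N + 1)) (hε : (ones ε).card = 0) :
    (transferMatrix (N + 1) t).mulVec (betheVector t (N + 1) p) ε =
      betheEigenvalue t (N + 1) p * betheVector t (N + 1) p ε := by
  have ht' : (t : ℂ) ≠ 0 := by exact_mod_cast ht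
  have e1 := (sum_mul_openSum t (fun k => Complex.exp (Complex.I * p k)) (fun k => k.elim0) false
    ε).1 (by simp [hε]) (coeffC t p) (fun k h => absurd h (by omega))
  have e2 := (sum_mul_openSum t (fun k => Complex.exp (Complex.I * p k)) (fun k => k.elim0) true
    ε).2 (by simp [hε]) (coeffC t p) (fun k h => absurd h (by omega))
  simp only [ladder_fst_eq_zero _ _ _ hε, ladder_false_snd, hε, (ladder_true _ _ _).2, if_true,
    Bool.false_eq_true, if_false, one_mul, mul_zero, add_zero, Finset.range_zero,
    Finset.prod_empty, mul_left_comm _ (t : ℂ), ← Finset.mul_sum] at e1 e2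
  rw [transferMatrix_mulVec_betheVector t p ε hε, betheVector_eq, if_pos hε, betheEigenvalue,
    if_pos fun j => j.elim0]
  simp only [mul_add, Finset.sum_add_distrib, e1, mul_left_cancel₀ ht' e2, Finset.univ_eq_empty,
    Finset.prod_empty]
  ring

end

end SquareIce

/-- **Coordinate Bethe ansatz** for the transfer matrices of square ice: if `p_1 < ⋯ < p_n` in
`I_t` satisfy the Bethe equations, then `V_N(t) ψ = Λ_{n,N}(t)[p] ψ` for `ψ = ψ_{t,n,N}(p)`. -/
theorem mainTheorem1 (t : ℝ) (ht : t ∈ Set.Ioo (0 : ℝ) 2) (N n : ℕ) (hN : 1 ≤ N)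
    (hn : (n : ℝ) ≤ (N : ℝ) / 2) (p : Fin n → ℝ) (hp : ∀ j, p j ∈ SquareIce.Interval t)
    (hmono : StrictMono p) (hBethe : SquareIce.BetheEquations t N p) :
    (SquareIce.transferMatrix N t).mulVec (SquareIce.betheVector t N p) =
      SquareIce.betheEigenvalue t N p • SquareIce.betheVector t N p := by
  obtain ⟨N, rfl⟩ : ∃ N', N = N' + 1 := ⟨N - 1, by omega⟩
  funext ε
  rw [Pi.smul_apply, smul_eq_mul]
  by_cases hε : (SquareIce.ones ε).card = n
  · cases n with
    | zero => exact SquareIce.mulVec_betheVector_of_empty ht.1.ne' p ε hε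
    | succ m =>
      by_cases h0 : ∀ j, p j ≠ 0
      · exact SquareIce.mulVec_betheVector_of_ne_zero ht hp hBethe h0 ε hε
      · push Not at h0
        obtain ⟨l, hl⟩ := h0
        exact SquareIce.mulVec_betheVector_of_eq_zero ht hp hBethe hl
          -- Distinct momenta leave only one that vanishes, hence a single pole.
          (fun k hk h => hk (hmono.injective (h.trans hl.symm))) ε hε
  · rw [SquareIce.transferMatrix_mulVec_betheVector_of_ne t p ε hε, SquareIce.betheVector_eq,
      if_neg hε, mul_zero]
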